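/- Let $q\ge 2$ and $b>q$ be integers with $b/q\in\mathbb Z$, and let $\mu_{q,b}$ be the Cantor measure, i.e. the unique Borel probability measure on $\mathbb R$ with $\mu_{q,b}=\frac1q\sum_{i=0}^{q-1}\mu_{q,b}(f_i^{-1}(\cdot))$, where $f_i(x)=x/b+i/q$. Let $\Sigma_q^n=\{0,\dots,q-1\}^n$ and $\Sigma_q^*=\bigcup_{1\le n<\infty}\Sigma_q^n$. For $\delta,\delta'\in\Sigma_q^*$ let $\delta\delta'$ be the concatenation, and for $k\ge1$ let $\delta|_k\in\Sigma_q^k$ consist of the first $k$ letters of $\delta000\cdots$. A map $\tau:\Sigma_q^*\to\{-1,0,\dots,b-2\}$ is a maximal tree mapping if (i) $\tau(0^n)=0$ for all $n\ge1$, where $0^n$ is the word of $n$ zeros; (ii) $\tau(\delta)\in\delta_n+q\mathbb Z$ for all $\delta=\delta_1\cdots\delta_n\in\Sigma_q^n$, $n\ge1$; (iii) for every $\delta\in\Sigma_q^*$ there is $\delta'\in\Sigma_q^*$ such that $\tau((\delta\delta')|_n)=0$ for all sufficiently large $n$. For such $\tau$ set $$\Lambda(\tau)=\Big\{\sum_{n=1}^\infty\tau(\delta|_n)b^{n-1}:\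 \delta\in\Sigma_q^*,\ \tau(\delta|_m)=0\text{ for all sufficiently large }m\Big\}.$$ For $\delta,\delta'\in\Sigma_q^*$ let $A_\delta(\delta')=\{m\ge1:\tau(\delta(\delta'|_m))\ne0\}=\{n_1<n_2<\cdots\}$, $n_0=0$, $B_\delta(\delta')=\{m\ge1:\tau(\delta(\delta'|_m))\notin q\mathbb Z\}\subset A_\delta(\delta')$, and define, with values in $[0,\infty]$, $$\mathcal D_{\tau,\delta}(\delta')=\#A_\delta(\delta')+\sum_{n_j\in B_\delta(\delta')}(n_j-n_{j-1}-1),\qquad \mathcal D_{\tau,\delta}=\inf_{\delta'\in\Sigma_q^*}\mathcal D_{\tau,\delta}(\delta').$$ Theorem. If $\tau:\Sigma_q^*\to\{-1,0,\dots,b-2\}$ is a maximal tree mapping such that $\mathcal D_\tau:=\sup_{\delta\in\Sigma_q^*}\mathcal D_{\tau,\delta}<\infty$, then $\Lambda(\tau)$ is a spectrum of $\mu_{q,b}$, i.e. $\{e^{-2\pi i\lambda x}:\lambda\in\Lambda(\tau)\}$ is an orthogonal basis of $L^2(\mu_{q,b})$. -/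

import Mathlib

open MeasureTheory ProbabilityTheory Filter
open scoped ENNReal

noncomputable section

namespace CantorTree

section Measure

/-- The point `∑ n, (d n / q) * b⁻ⁿ` of the attractor of the maps
`f i x = x / b + i / q` (`0 ≤ i < q`) whose address is `d`. -/
def point (q b : ℕ) (d : ℕ → Fin q) : ℝ :=
  ∑' n : ℕ, ((d n : ℕ) : ℝ) / q * ((b : ℝ)⁻¹) ^ n

/-- The Cantor measure `μ_{q,b}`: the law of `point q b d` for independent, uniformly distributed
digits `d 0, d 1, …` in `{0, …, q - 1}`. It is the self-similar probability measure of the maps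
`f i x = x / b + i / q` with equal weights, see `cantorMeasure_selfSimilar`. -/
def cantorMeasure (q b : ℕ) [NeZero q] : Measure ℝ :=
  (Measure.infinitePi fun _ : ℕ => uniformOn (Set.univ : Set (Fin q))).map (point q b)

theorem measurable_point (q b : ℕ) : Measurable (point q b) :=
  Measurable.tsum fun n => (measurable_from_top (f := fun i : Fin q =>
    ((i : ℕ) : ℝ) / q * ((b : ℝ)⁻¹) ^ n)).comp (measurable_pi_apply n)

instance (q b : ℕ) [NeZero q] : IsProbabilityMeasure (cantorMeasure q b) :=
  Measure.isProbabilityMeasure_map (measurable_point q b).aemeasurable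

/-- Prepend a digit to an address. -/
def prepend {q : ℕ} (p : Fin q × (ℕ → Fin q)) : ℕ → Fin q :=
  fun n => Nat.casesOn n p.1 p.2

theorem measurable_prepend {q : ℕ} : Measurable (prepend (q := q)) := by
  refine measurable_pi_lambda _ fun n => ?_
  cases n with
  | zero => exact measurable_fst
  | succ n => exact (measurable_pi_apply n).comp measurable_snd

theorem map_prepend (q : ℕ) [NeZero q] :
    ((uniformOn (Set.univ : Set (Fin q))).prod
      (Measure.infinitePi fun _ : ℕ => uniformOn (Set.univ : Set (Fin q)))).map prepend =
    Measure.infinitePi fun _ : ℕ => uniformOn (Set.univ : Set (Fin q)) := by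
  classical
  refine Measure.eq_infinitePi _ fun s t ht => ?_
  obtain ⟨N, hN⟩ : ∃ N, s ⊆ Finset.range (N + 1) :=
    ⟨s.sup id, fun n hn => Finset.mem_range.2 (Nat.lt_succ_of_le (Finset.le_sup (f := id) hn))⟩
  set t' : ℕ → Set (Fin q) := fun n => if n ∈ s then t n else Set.univ with ht'
  have ht'm : ∀ n, MeasurableSet (t' n) := fun n => by
    simp only [ht']; split_ifs
    exacts [ht n, MeasurableSet.univ]
  have hpre : prepend ⁻¹' (Set.pi (s : Set ℕ) t) =
      t' 0 ×ˢ Set.pi (Finset.range N : Set ℕ) (fun n => t' (n + 1)) := by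
    ext ⟨a, d⟩
    simp only [Set.mem_preimage, Set.mem_pi, Set.mem_prod, Finset.mem_coe, ht']
    constructor
    · intro h
      refine ⟨?_, fun n _ => ?_⟩
      · split_ifs with h0
        exacts [h 0 h0, trivial]
      · split_ifs with h0
        exacts [h (n + 1) h0, trivial]
    · rintro ⟨h0, h1⟩ n hn
      cases n with
      | zero => simpa [hn, prepend] using h0
      | succ n =>
        have hlt := Finset.mem_range.1 (hN hn)
        simpa [hn, prepend] using h1 n (Finset.mem_range.2 (by omega))
  rw [Measure.map_apply measurable_prepend
    (MeasurableSet.pi s.countable_toSet fun n _ => ht n), hpre, Measure.prod_prod,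
    Measure.infinitePi_pi _ (fun n _ => ht'm (n + 1)), mul_comm,
    ← Finset.prod_range_succ' (fun n => uniformOn (Set.univ : Set (Fin q)) (t' n)) N,
    ← Finset.prod_subset hN]
  · exact Finset.prod_congr rfl fun n hn => by simp [ht', hn]
  · intro n _ hn
    simp [ht', hn]

theorem point_prepend {q b : ℕ} (hb : 1 < b) (p : Fin q × (ℕ → Fin q)) :
    point q b (prepend p) = point q b p.2 / b + ((p.1 : ℕ) : ℝ) / q := by
  have hb' : (1 : ℝ) < b := by exact_mod_cast hb
  have hs : ∀ d : ℕ → Fin q, Summable fun n : ℕ => ((d n : ℕ) : ℝ) / q * ((b : ℝ)⁻¹) ^ n := by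
    intro d
    refine Summable.of_nonneg_of_le (fun n => by positivity) (fun n => ?_)
      (summable_geometric_of_lt_one (by positivity) (inv_lt_one_of_one_lt₀ hb'))
    refine mul_le_of_le_one_left (by positivity) (div_le_one_of_le₀ ?_ (by positivity))
    exact_mod_cast (d n).2.le
  unfold point
  rw [(hs _).tsum_eq_zero_add, ← tsum_div_const, add_comm]
  congr 1
  · refine tsum_congr fun n => ?_
    simp only [prepend, pow_succ]
    field_simp
  · simp [prepend]

/-- The defining equation `μ = (1/q) ∑ i, μ ∘ (f i)⁻¹` of the Cantor measure. -/
theorem cantorMeasure_selfSimilar (q b : ℕ) [NeZero q] (hb : 1 < b) :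
    cantorMeasure q b = (q : ℝ≥0∞)⁻¹ • ∑ i : Fin q,
      (cantorMeasure q b).map (fun x : ℝ => x / b + ((i : ℕ) : ℝ) / q) := by
  have hm : ∀ i : Fin q, Measurable (fun x : ℝ => x / b + ((i : ℕ) : ℝ) / q) :=
    fun i => by fun_prop
  set ν := Measure.infinitePi fun _ : ℕ => uniformOn (Set.univ : Set (Fin q)) with hν
  have hu : uniformOn (Set.univ : Set (Fin q)) =
      (q : ℝ≥0∞)⁻¹ • ∑ i : Fin q, Measure.dirac i := by
    ext A hA
    rw [uniformOn_univ, ENNReal.div_eq_inv_mul, Fintype.card_fin, Measure.smul_apply,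
      ← Measure.sum_fintype, Measure.count, smul_eq_mul]
  have hF : Measurable fun p : Fin q × (ℕ → Fin q) =>
      point q b p.2 / b + ((p.1 : ℕ) : ℝ) / q :=
    (((measurable_point q b).comp measurable_snd).div_const _).add
      ((measurable_from_top (f := fun i : Fin q => ((i : ℕ) : ℝ) / q)).comp measurable_fst)
  have h1 : cantorMeasure q b = ((uniformOn (Set.univ : Set (Fin q))).prod ν).map
      (fun p => point q b p.2 / b + ((p.1 : ℕ) : ℝ) / q) := by
    rw [cantorMeasure, ← hν]
    nth_rewrite 1 [hν]
    rw [← map_prepend q, Measure.map_map (measurable_point q b) measurable_prepend]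
    congr 1
    funext p
    exact point_prepend hb p
  have h2 : ∀ i : Fin q, (cantorMeasure q b).map (fun x : ℝ => x / b + ((i : ℕ) : ℝ) / q) =
      ((Measure.dirac i).prod ν).map (fun p => point q b p.2 / b + ((p.1 : ℕ) : ℝ) / q) := by
    intro i
    rw [cantorMeasure, ← hν, Measure.map_map (hm i) (measurable_point q b),
      Measure.dirac_prod, Measure.map_map hF (by fun_prop)]
    rfl
  simp_rw [h2]
  ext A hA
  rw [h1, Measure.map_apply hF hA, Measure.prod_apply (hF hA), hu, lintegral_smul_measure,
    lintegral_finsetSum_measure]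
  simp only [Measure.smul_apply, Measure.finsetSum_apply]
  congr 1
  refine Finset.sum_congr rfl fun i _ => ?_
  rw [Measure.map_apply hF hA, Measure.prod_apply (hF hA)]

end Measure

section Spectrum

/-- The exponential `x ↦ exp (-2πi l x)`. -/
def expFun (l : ℝ) (x : ℝ) : ℂ := Complex.exp (-(2 * Real.pi * l * x : ℝ) * Complex.I)

theorem memLp_expFun (μ : Measure ℝ) [IsFiniteMeasure μ] (l : ℝ) : MemLp (expFun l) 2 μ := by
  have hc : Continuous (expFun l) := by unfold expFun; fun_prop
  refine MemLp.of_bound hc.aestronglyMeasurable 1 (Eventually.of_forall fun x => ?_)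
  rw [expFun, ← Complex.ofReal_neg, Complex.norm_exp_ofReal_mul_I]

/-- The exponential `x ↦ exp (-2πi l x)` as an element of `L²(μ)`. -/
def expL2 (μ : Measure ℝ) [IsFiniteMeasure μ] (l : ℝ) : Lp ℂ 2 μ := (memLp_expFun μ l).toLp

/-- `Λ` is a spectrum of `μ`: the exponentials `exp (-2πi l x)`, `l ∈ Λ`, form an orthogonal
basis of the Hilbert space `L²(μ)`. -/
structure IsSpectrum (μ : Measure ℝ) [IsProbabilityMeasure μ] (Λ : Set ℝ) : Prop where
  orthogonal : ∀ l ∈ Λ, ∀ l' ∈ Λ, l ≠ l' → inner ℂ (expL2 μ l) (expL2 μ l') = 0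
  complete : (Submodule.span ℂ (expL2 μ '' Λ)).topologicalClosure = ⊤

end Spectrum

section Tree

variable {q : ℕ} [NeZero q]

/-- `δ|ₖ`: the first `k` letters of `δ000⋯`.  Finite tree branches are the nonempty words over
`{0, …, q - 1}`, that is, the lists `δ : List (Fin q)` with `δ ≠ []`. -/
def trunc (δ : List (Fin q)) (k : ℕ) : List (Fin q) :=
  δ.take k ++ List.replicate (k - δ.length) 0

/-- Tree mappings `τ : Σ_q^* → {-1, 0, …, b - 2}`. Only the values of `τ` at nonempty words
matter; the value `τ []` is never used. -/
structure IsTreeMapping (b : ℕ) (τ : List (Fin q) → ℤ) : Prop where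
  range : ∀ δ, δ ≠ [] → -1 ≤ τ δ ∧ τ δ ≤ (b : ℤ) - 2
  zero : ∀ n : ℕ, 1 ≤ n → τ (List.replicate n 0) = 0
  congr : ∀ (δ : List (Fin q)) (h : δ ≠ []), τ δ ≡ ((δ.getLast h : ℕ) : ℤ) [ZMOD q]

/-- `τ (δ|ₘ) = 0` for all sufficiently large `m`. -/
def IsRegular (τ : List (Fin q) → ℤ) (δ : List (Fin q)) : Prop :=
  ∀ᶠ m in atTop, τ (trunc δ m) = 0

/-- Maximal tree mappings: every branch can be continued to a regular one. -/
structure IsMaximalTreeMapping (b : ℕ) (τ : List (Fin q) → ℤ) : Prop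
    extends IsTreeMapping b τ where
  maximal : ∀ δ, δ ≠ [] → ∃ δ', δ' ≠ [] ∧ IsRegular τ (δ ++ δ')

/-- `Λ(τ) = { ∑_{n ≥ 1} τ(δ|ₙ) bⁿ⁻¹ : δ a regular finite branch }`
(each of these sums has finitely many nonzero terms). -/
def spectrumSet (b : ℕ) (τ : List (Fin q) → ℤ) : Set ℝ :=
  {x | ∃ δ : List (Fin q), δ ≠ [] ∧ IsRegular τ δ ∧
    x = ∑' n : ℕ, (τ (trunc δ (n + 1)) : ℝ) * (b : ℝ) ^ n}

/-- `A_δ(δ')`: the levels `m ≥ 1` above `δ` at which the branch `δδ'000⋯` has a nonzero label. -/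
def levelA (τ : List (Fin q) → ℤ) (δ δ' : List (Fin q)) : Set ℕ :=
  {m | 1 ≤ m ∧ τ (δ ++ trunc δ' m) ≠ 0}

/-- `B_δ(δ')`: the levels `m ≥ 1` above `δ` at which the label is not a multiple of `q`. -/
def levelB (τ : List (Fin q) → ℤ) (δ δ' : List (Fin q)) : Set ℕ :=
  {m | 1 ≤ m ∧ ¬ (q : ℤ) ∣ τ (δ ++ trunc δ' m)}

/-- For `n = n_j` in `A = {n_1 < n_2 < ⋯}`, the preceding element `n_{j-1}`, with `n_0 = 0`. -/
def pred (A : Set ℕ) (n : ℕ) : ℕ := sSup (insert 0 A ∩ Set.Iio n)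

/-- `D_{τ,δ}(δ') = #A_δ(δ') + ∑_{n_j ∈ B_δ(δ')} (n_j - n_{j-1} - 1)`, possibly infinite. -/
def levelDiffAt (τ : List (Fin q) → ℤ) (δ δ' : List (Fin q)) : ℝ≥0∞ :=
  ((levelA τ δ δ').encard : ℝ≥0∞) +
    ∑' n : levelB τ δ δ', (((n : ℕ) - pred (levelA τ δ δ') n - 1 : ℕ) : ℝ≥0∞)

/-- `D_{τ,δ}`, the infimum of `D_{τ,δ}(δ')` over all finite branches `δ'`. -/
def levelDiff (τ : List (Fin q) → ℤ) (δ : List (Fin q)) : ℝ≥0∞ :=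
  ⨅ (δ' : List (Fin q)) (_ : δ' ≠ []), levelDiffAt τ δ δ'

/-- `D_τ`, the supremum of `D_{τ,δ}` over all finite branches `δ`. -/
def levelDiffSup (τ : List (Fin q) → ℤ) : ℝ≥0∞ :=
  ⨆ (δ : List (Fin q)) (_ : δ ≠ []), levelDiff τ δ

end Tree

end CantorTree

end

/-! Write `μ̂` for `cantorFourier q b`. Orthogonality: if two regular words first disagree at
position `k`, their frequencies differ by `b ^ k * m` with `m` not divisible by `q`, and the factor
`mask q m` of `μ̂` vanishes there.

Completeness: the exponentials span a dense subspace of `L²(μ)`, so it is enough that Bessel's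
inequality is an equality at each of them, that is, `∑ |μ̂(ξ + λ)|² ≥ 1` for every `ξ`. The identity
`μ̂(t) = mask q t * μ̂(t / b)` makes this a statement about a random walk on the tree. The labels of
the children of a node represent all residues mod `q`, so the numbers `|mask q (state δ + τ (δj))|²`
are transition probabilities, and the walk follows a regular word of frequency `λ` forever with
probability `|μ̂(ξ + λ)|²` (`tendsto_weight_pre`). The claim becomes that the walk almost surely
ends in a regular word.

By `le_of_uniform_escape` it suffices that deep nodes with nonzero label have a regular continuation
of conditional probability bounded below, nodes followed only by zero labels being treated directly.
The bound comes from following the potential `weight δ * |μ̂(state δ)|²` along a branch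
(`pow_mul_weight_le`). A zero label costs nothing and a nonzero multiple of `q` costs a constant.
Any other label after `g` zero labels costs a factor `ρ ^ (1 + g)`: the state may have shrunk to the
order of `b⁻ᵍ`, and `mask q` vanishes at integers outside `qℤ`. The exponents add up to the level
difference, which is bounded. -/

noncomputable section

namespace CantorTree

open scoped ComplexConjugate Topology

/-! ### Exponentials. -/

section Exponential

theorem expFun_add (s t x : ℝ) : expFun (s + t) x = expFun s x * expFun t x := by
  rw [expFun, expFun, expFun, ← Complex.exp_add]
  congr 1
  push_cast
  ring

theorem expFun_add_right (t x y : ℝ) : expFun t (x + y) = expFun t x * expFun t y := by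
  rw [expFun, expFun, expFun, ← Complex.exp_add]
  congr 1
  push_cast
  ring

theorem expFun_div_right (t x c : ℝ) : expFun t (x / c) = expFun (t / c) x := by
  rw [expFun, expFun]
  congr 4
  ring

theorem norm_expFun (t x : ℝ) : ‖expFun t x‖ = 1 := by
  rw [expFun, ← Complex.ofReal_neg, Complex.norm_exp_ofReal_mul_I]

theorem conj_expFun (t x : ℝ) : conj (expFun t x) = expFun (-t) x := by
  rw [expFun, expFun, ← Complex.exp_conj]
  congr 1
  simp only [map_mul, map_neg, Complex.conj_ofReal, Complex.conj_I]
  push_cast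
  ring

@[simp] theorem expFun_zero (x : ℝ) : expFun 0 x = 1 := by simp [expFun]

theorem expFun_nat_mul_right (t x : ℝ) (n : ℕ) : expFun t (n * x) = expFun t x ^ n := by
  rw [expFun, expFun, ← Complex.exp_nat_mul]
  congr 1
  push_cast
  ring

theorem expFun_int_one (z : ℤ) : expFun z 1 = 1 := by
  rw [expFun, Complex.exp_eq_one_iff]
  refine ⟨-z, ?_⟩
  push_cast
  ring

theorem expFun_one_eq_one_iff (t : ℝ) : expFun t 1 = 1 ↔ ∃ z : ℤ, t = z := by
  constructor
  · intro h
    rw [expFun, Complex.exp_eq_one_iff] at h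
    obtain ⟨n, hn⟩ := h
    refine ⟨-n, ?_⟩
    have h2 : (-(2 * Real.pi * t * 1 : ℝ) : ℂ) * Complex.I
        = ((n : ℝ) * (2 * Real.pi) : ℝ) * Complex.I := by
      rw [hn]; push_cast; ring
    have h3 := mul_right_cancel₀ Complex.I_ne_zero h2
    rw [← Complex.ofReal_neg] at h3
    have h4 := Complex.ofReal_injective h3
    have hpi := Real.pi_pos
    push_cast
    have : (2 * Real.pi) * (t + n) = 0 := by linarith
    rcases mul_eq_zero.1 this with h | h
    · exact absurd h (by positivity)
    · linarith
  · rintro ⟨z, rfl⟩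
    exact expFun_int_one z

theorem norm_one_sub_expFun_one (t : ℝ) : ‖1 - expFun t 1‖ = 2 * |Real.sin (Real.pi * t)| := by
  have h : expFun t 1 = Complex.exp (Complex.I * ((-(2 * Real.pi * t) : ℝ) : ℂ)) := by
    rw [expFun]; congr 1; push_cast; ring
  rw [norm_sub_rev, h, Complex.norm_exp_I_mul_ofReal_sub_one, norm_mul, Real.norm_eq_abs,
    Real.norm_eq_abs, abs_two]
  congr 1
  rw [show -(2 * Real.pi * t) / 2 = -(Real.pi * t) by ring, Real.sin_neg, abs_neg]

theorem continuous_expFun (t : ℝ) : Continuous (expFun t) := by unfold expFun; fun_prop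

theorem integrable_expFun (μ : Measure ℝ) [IsFiniteMeasure μ] (t : ℝ) :
    Integrable (expFun t) μ :=
  Integrable.of_bound (continuous_expFun t).aestronglyMeasurable 1
    (Eventually.of_forall fun x => (norm_expFun t x).le)

end Exponential

/-! ### The mask polynomial: periodicity, zeros and lower bounds. -/

section Mask

/-- The Fourier transform of the uniform probability measure on `{0, 1/q, …, (q-1)/q}`. -/
def mask (q : ℕ) (t : ℝ) : ℂ := (q : ℂ)⁻¹ * ∑ i : Fin q, expFun t (((i : ℕ) : ℝ) / q)

theorem mask_eq_geom_sum (q : ℕ) (t : ℝ) :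
    mask q t = (q : ℂ)⁻¹ * ∑ i ∈ Finset.range q, expFun (t / q) 1 ^ i := by
  rw [mask, ← Fin.sum_univ_eq_sum_range (fun i => expFun (t / q) 1 ^ i)]
  congr 1
  refine Finset.sum_congr rfl fun i _ => ?_
  rw [expFun_div_right, ← expFun_nat_mul_right, mul_one]

variable {q : ℕ} [NeZero q]

theorem expFun_div_one_pow (t : ℝ) : expFun (t / q) 1 ^ q = expFun t 1 := by
  rw [← expFun_div_right, ← expFun_nat_mul_right]
  congr 1
  have : (q : ℝ) ≠ 0 := by exact_mod_cast NeZero.ne q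
  field_simp

theorem one_sub_mul_mask (t : ℝ) :
    (1 - expFun (t / q) 1) * (q * mask q t) = 1 - expFun t 1 := by
  have : (q : ℂ) ≠ 0 := by exact_mod_cast NeZero.ne q
  rw [mask_eq_geom_sum, mul_inv_cancel_left₀ this, mul_neg_geom_sum, expFun_div_one_pow]

theorem mask_add_mul_int (t : ℝ) (z : ℤ) : mask q (t + q * z) = mask q t := by
  have : (q : ℝ) ≠ 0 := by exact_mod_cast NeZero.ne q
  rw [mask_eq_geom_sum, mask_eq_geom_sum, add_div, mul_div_cancel_left₀ _ this, expFun_add,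
    expFun_int_one, mul_one]

theorem mask_add_congr (t : ℝ) {m n : ℤ} (h : m ≡ n [ZMOD q]) :
    mask q (t + m) = mask q (t + n) := by
  obtain ⟨z, hz⟩ := h.symm.dvd
  obtain rfl : m = n + q * z := by linarith
  rw [← mask_add_mul_int (t + n) z]
  push_cast
  ring_nf

@[simp] theorem mask_zero : mask q 0 = 1 := by
  have : (q : ℂ) ≠ 0 := by exact_mod_cast NeZero.ne q
  simp [mask, this]

theorem mask_int_eq_zero {m : ℤ} (h : ¬ (q : ℤ) ∣ m) : mask q m = 0 := by
  have hq : (q : ℝ) ≠ 0 := by exact_mod_cast NeZero.ne q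
  have h1 := one_sub_mul_mask (q := q) (m : ℝ)
  rw [expFun_int_one, sub_self] at h1
  rcases mul_eq_zero.1 h1 with h2 | h2
  · obtain ⟨z, hz⟩ := (expFun_one_eq_one_iff _).1 (sub_eq_zero.1 h2).symm
    refine absurd ⟨z, ?_⟩ h
    rw [div_eq_iff hq] at hz
    have : (m : ℝ) = ((q * z : ℤ) : ℝ) := by rw [hz]; push_cast; ring
    exact_mod_cast this
  · exact (mul_eq_zero.1 h2).resolve_left (by exact_mod_cast NeZero.ne q)

/-- Parseval on `ℤ/q`: expanding the squares leaves character sums over `j`, which vanish off the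
diagonal. -/
theorem sum_norm_mask_add_nat_sq (t : ℝ) : ∑ j : Fin q, ‖mask q (t + (j : ℕ))‖ ^ 2 = 1 := by
  have hq : (q : ℂ) ≠ 0 := by exact_mod_cast NeZero.ne q
  have key : ∀ i i' : Fin q, ∑ j : Fin q, expFun (t + (j : ℕ)) (((i : ℕ) : ℝ) / q) *
      conj (expFun (t + (j : ℕ)) (((i' : ℕ) : ℝ) / q)) = if i = i' then (q : ℂ) else 0 := by
    intro i i'
    set d : ℤ := (i : ℤ) - i' with hd
    have h1 : ∀ j : Fin q, expFun (t + (j : ℕ)) (((i : ℕ) : ℝ) / q) *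
        conj (expFun (t + (j : ℕ)) (((i' : ℕ) : ℝ) / q)) =
        expFun t ((d : ℝ) / q) * expFun ((d : ℝ) / q) 1 ^ (j : ℕ) := by
      intro j
      rw [conj_expFun, ← expFun_nat_mul_right]
      simp only [expFun]
      rw [← Complex.exp_add, ← Complex.exp_add]
      congr 1
      rw [hd]
      push_cast
      ring
    simp_rw [h1]
    rw [← Finset.mul_sum, Fin.sum_univ_eq_sum_range (fun j => expFun ((d : ℝ) / q) 1 ^ j)]
    split_ifs with h
    · subst h
      simp [hd, expFun]
    · have h2 : mask q d = 0 := by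
        refine mask_int_eq_zero fun hdvd => h ?_
        have := Int.eq_zero_of_abs_lt_dvd hdvd (by rw [abs_lt]; omega)
        ext
        omega
      rw [mask_eq_geom_sum] at h2
      rw [(mul_eq_zero.1 h2).resolve_left (inv_ne_zero hq), mul_zero]
  have : (∑ j : Fin q, (‖mask q (t + (j : ℕ))‖ ^ 2 : ℝ) : ℂ) = 1 := by
    push_cast
    simp_rw [← Complex.mul_conj', mask, map_mul, map_sum, mul_mul_mul_comm, Finset.sum_mul_sum]
    rw [← Finset.mul_sum, Finset.sum_comm]
    simp_rw [Finset.sum_comm (s := Finset.univ (α := Fin q)) (t := Finset.univ (α := Fin q))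
      (f := fun j x => expFun (t + (j : ℕ)) _ * _)]
    simp_rw [key]
    simp only [Finset.sum_ite_eq, Finset.mem_univ, if_true, Finset.sum_const, Finset.card_univ,
      Fintype.card_fin, nsmul_eq_mul, map_inv₀, map_natCast]
    field_simp
  exact_mod_cast this

/-- Jordan's inequality around the nearest integer, `0` or `1`. Near `1` the factor `1 / b` is lost,
since there `1 - y ≥ 1 / b ≥ |y| / b`. -/
theorem two_mul_abs_le_abs_sin_pi_mul {b : ℕ} (hb : 2 ≤ b) {y : ℝ} (h1 : -(1 / 2) ≤ y)
    (h2 : y ≤ 1 - 1 / b) : 2 / b * |y| ≤ |Real.sin (Real.pi * y)| := by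
  have hpi := Real.pi_pos
  have hb' : (2 : ℝ) ≤ b := by exact_mod_cast hb
  have hs : ∀ u : ℝ, |u| ≤ 1 / 2 → 2 * |u| ≤ |Real.sin (Real.pi * u)| := by
    intro u hu
    have := Real.mul_abs_le_abs_sin (x := Real.pi * u) (by
      rw [abs_mul, abs_of_pos hpi]; nlinarith)
    rw [abs_mul, abs_of_pos hpi] at this
    convert this using 1
    field_simp
  have hb1 : 2 / (b : ℝ) ≤ 1 := by rw [div_le_one (by linarith)]; exact hb'
  rcases le_or_gt y (1 / 2) with h | h
  · refine le_trans ?_ (hs y (abs_le.2 ⟨by linarith, h⟩))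
    exact mul_le_mul_of_nonneg_right (by linarith) (abs_nonneg _)
  · have h3 := hs (1 - y) (abs_le.2 ⟨by
      have : (0 : ℝ) < 1 / b := by positivity
      linarith, by linarith⟩)
    rw [show Real.pi * (1 - y) = Real.pi - Real.pi * y by ring, Real.sin_pi_sub] at h3
    refine le_trans ?_ h3
    have h4 : (0 : ℝ) < 1 / b := by positivity
    rw [abs_of_pos (by linarith), abs_of_pos (by linarith : 0 < 1 - y)]
    have h5 : 2 / (b : ℝ) = 2 * (1 / b) := by ring
    rw [h5]
    nlinarith

/-- The geometric sum identity bounds the mask below by `|sin (π y)| / q`, whatever the integer `z`.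
-/
theorem le_norm_mask_add_int {b : ℕ} (hb : 2 ≤ b) {y : ℝ} (h1 : -(1 / 2) ≤ y)
    (h2 : y ≤ 1 - 1 / b) (z : ℤ) : 2 / (q * b) * |y| ≤ ‖mask q (y + z)‖ := by
  have hq : (0 : ℝ) < q := by exact_mod_cast NeZero.pos q
  have h := congrArg norm (one_sub_mul_mask (q := q) (y + z))
  rw [expFun_add y z 1, expFun_int_one, mul_one, norm_one_sub_expFun_one, norm_mul, norm_mul,
    Complex.norm_natCast] at h
  have h3 : ‖1 - expFun ((y + z) / q) 1‖ ≤ 2 := by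
    refine (norm_sub_le _ _).trans ?_
    rw [norm_one, norm_expFun]; norm_num
  have h4 := two_mul_abs_le_abs_sin_pi_mul hb h1 h2
  have h5 : 2 * |Real.sin (Real.pi * y)| ≤ 2 * (q * ‖mask q (y + z)‖) := by
    rw [← h]
    exact mul_le_mul_of_nonneg_right h3 (by positivity)
  have h6 : 2 / (q * b) * |y| = (2 / b * |y|) / q := by field_simp
  rw [h6, div_le_iff₀ hq]
  linarith

theorem mask_ne_zero {b : ℕ} (hb : 2 ≤ b) {y : ℝ} (h1 : -(1 / 2) ≤ y)
    (h2 : y ≤ 1 - 1 / b) : mask q y ≠ 0 := by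
  have hq : (0 : ℝ) < q := by exact_mod_cast NeZero.pos q
  have hb' : (2 : ℝ) ≤ b := by exact_mod_cast hb
  rcases eq_or_ne y 0 with rfl | h
  · simp
  · have := le_norm_mask_add_int (q := q) hb h1 h2 0
    rw [Int.cast_zero, add_zero] at this
    have h3 : 0 < 2 / (q * b) * |y| := by positivity
    exact norm_pos_iff.1 (h3.trans_le this)

end Mask

/-! ### The Fourier transform of the Cantor measure. -/

section Transform

/-- The Fourier transform of the Cantor measure. -/
def cantorFourier (q b : ℕ) [NeZero q] (t : ℝ) : ℂ := ∫ x, expFun t x ∂cantorMeasure q b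

variable {q b : ℕ} [NeZero q]

@[simp] theorem cantorFourier_zero : cantorFourier q b 0 = 1 := by simp [cantorFourier]

theorem norm_cantorFourier_le_one (t : ℝ) : ‖cantorFourier q b t‖ ≤ 1 := by
  refine (norm_integral_le_integral_norm _).trans ?_
  simp [norm_expFun]

theorem norm_cantorFourier_neg (t : ℝ) : ‖cantorFourier q b (-t)‖ = ‖cantorFourier q b t‖ := by
  rw [cantorFourier, cantorFourier, ← RCLike.norm_conj, ← integral_conj]
  simp_rw [conj_expFun, neg_neg]

theorem continuous_cantorFourier : Continuous (cantorFourier q b) := by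
  refine continuous_of_dominated (bound := fun _ => 1)
    (fun t => (continuous_expFun t).aestronglyMeasurable)
    (fun t => Eventually.of_forall fun x => (norm_expFun t x).le) (integrable_const _)
    (Eventually.of_forall fun x => ?_)
  unfold expFun
  fun_prop

theorem cantorFourier_eq_mask_mul (hb : 1 < b) (t : ℝ) :
    cantorFourier q b t = mask q t * cantorFourier q b (t / b) := by
  have hm : ∀ i : Fin q, Measurable (fun x : ℝ => x / b + ((i : ℕ) : ℝ) / q) :=
    fun i => by fun_prop
  rw [cantorFourier]
  nth_rewrite 1 [cantorMeasure_selfSimilar q b hb]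
  rw [integral_smul_measure, integral_finsetSum_measure]
  · simp_rw [fun i : Fin q => integral_map (hm i).aemeasurable
      (μ := cantorMeasure q b) (f := expFun t) (continuous_expFun t).aestronglyMeasurable,
      expFun_add_right, integral_mul_const, expFun_div_right t _ (b : ℝ)]
    rw [← Finset.mul_sum, mask, cantorFourier, ENNReal.toReal_inv, ENNReal.toReal_natCast,
      Complex.real_smul]
    push_cast
    ring
  · intro i _
    have := Measure.isProbabilityMeasure_map (μ := cantorMeasure q b) (hm i).aemeasurable
    exact integrable_expFun _ t

theorem cantorFourier_eq_prod_mul (hb : 1 < b) (t : ℝ) (n : ℕ) :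
    cantorFourier q b t =
      (∏ k ∈ Finset.range n, mask q (t / b ^ k)) * cantorFourier q b (t / b ^ n) := by
  induction n with
  | zero => simp
  | succ n ih =>
    rw [ih, Finset.prod_range_succ, cantorFourier_eq_mask_mul hb (t / b ^ n), mul_assoc, pow_succ,
      div_div]

/-- No factor `mask q (y / b ^ k)` vanishes, because `y / b ^ k` stays in the same interval, and
`μ̂` is close to `1` near `0`. Compactness makes the bound uniform. -/
theorem exists_le_norm_cantorFourier (hb : 2 ≤ b) : ∃ c : ℝ, 0 < c ∧ ∀ y : ℝ, -(1 / 2) ≤ y →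
    y ≤ 1 - 1 / b → c ≤ ‖cantorFourier q b y‖ := by
  have hb' : (2 : ℝ) ≤ b := by exact_mod_cast hb
  have hlim : Tendsto (fun t => ‖cantorFourier q b t‖) (𝓝 0) (𝓝 1) := by
    have := (continuous_cantorFourier (q := q) (b := b)).norm.tendsto 0
    simpa using this
  have hne : ∀ y : ℝ, -(1 / 2) ≤ y → y ≤ 1 - 1 / b → cantorFourier q b y ≠ 0 := by
    intro y h1 h2
    have h3 : Tendsto (fun n : ℕ => y / (b : ℝ) ^ n) atTop (𝓝 0) :=
      tendsto_const_nhds.div_atTop (tendsto_pow_atTop_atTop_of_one_lt (by linarith))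
    obtain ⟨n, hn⟩ := ((hlim.comp h3).eventually (lt_mem_nhds one_pos)).exists
    rw [cantorFourier_eq_prod_mul (by omega) y n]
    refine mul_ne_zero (Finset.prod_ne_zero_iff.2 fun k _ => ?_) (norm_pos_iff.1 hn)
    have hk : (1 : ℝ) ≤ b ^ k := one_le_pow₀ (by linarith)
    refine mask_ne_zero hb ?_ ?_
    · rw [le_div_iff₀ (by linarith)]
      nlinarith
    · rw [div_le_iff₀ (by linarith)]
      have : 1 / (b : ℝ) ≤ 1 / 2 := by gcongr
      nlinarith
  have hb2 : 1 / (b : ℝ) ≤ 1 / 2 := by gcongr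
  obtain ⟨y, hy, hmin⟩ := (isCompact_Icc (a := -(1 / 2 : ℝ)) (b := 1 - 1 / b)).exists_isMinOn
    ⟨0, by constructor <;> linarith⟩ (continuous_cantorFourier (q := q) (b := b)).norm.continuousOn
  exact ⟨_, norm_pos_iff.2 (hne y hy.1 hy.2), fun z h1 h2 => hmin ⟨h1, h2⟩⟩

theorem inner_expL2 (μ : Measure ℝ) [IsFiniteMeasure μ] (l l' : ℝ) :
    inner ℂ (expL2 μ l) (expL2 μ l') = ∫ x, expFun (l' - l) x ∂μ := by
  rw [L2.inner_def]
  refine integral_congr_ae ?_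
  filter_upwards [(memLp_expFun μ l).coeFn_toLp, (memLp_expFun μ l').coeFn_toLp] with x h1 h2
  rw [expL2, expL2, h1, h2, RCLike.inner_apply, conj_expFun, ← expFun_add, sub_eq_add_neg]

end Transform

/-! ### Density of the exponentials in `L²`. -/

section Density

variable {μ : Measure ℝ}

/-- The positive and negative parts of `g` are densities of finite measures with the same
characteristic function, so these measures coincide. -/
theorem ae_eq_zero_of_integral_ofReal_mul_expFun_eq_zero {g : ℝ → ℝ} (hg : Integrable g μ)
    (h : ∀ t, ∫ x, (g x : ℂ) * expFun t x ∂μ = 0) : g =ᵐ[μ] 0 := by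
  have hf : ∀ g : ℝ → ℝ, Integrable g μ →
      IsFiniteMeasure (μ.withDensity fun x => ENNReal.ofReal (g x)) := fun g hg =>
    isFiniteMeasure_withDensity_ofReal hg.2
  have hm : ∀ g : ℝ → ℝ, Integrable g μ → AEMeasurable (fun x => ENNReal.ofReal (g x)) μ :=
    fun g hg => hg.aestronglyMeasurable.aemeasurable.ennreal_ofReal
  have hi : ∀ g : ℝ → ℝ, Integrable g μ → ∀ t,
      Integrable (fun x => ((max (g x) 0 : ℝ) : ℂ) * expFun t x) μ := by
    intro g hg t
    refine (hg.pos_part.ofReal (𝕜 := ℂ)).mul_bdd (c := 1)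
      (continuous_expFun t).aestronglyMeasurable (Eventually.of_forall fun x => ?_)
    exact (norm_expFun t x).le
  have hint : ∀ g : ℝ → ℝ, Integrable g μ → ∀ t,
      charFun (μ.withDensity fun x => ENNReal.ofReal (g x)) t =
        ∫ x, ((max (g x) 0 : ℝ) : ℂ) * expFun (-(t / (2 * Real.pi))) x ∂μ := by
    intro g hg t
    rw [charFun_apply_real, integral_withDensity_eq_integral_toReal_smul₀ (hm g hg)
      (Eventually.of_forall fun x => ENNReal.ofReal_lt_top)]
    refine integral_congr_ae (Eventually.of_forall fun x => ?_)
    simp only [ENNReal.toReal_ofReal', Complex.real_smul, expFun]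
    congr 2
    have : (Real.pi : ℂ) ≠ 0 := by exact_mod_cast Real.pi_ne_zero
    push_cast
    field_simp
  have h1 := hf g hg
  have h2 := hf (fun x => -g x) hg.neg
  have heq : μ.withDensity (fun x => ENNReal.ofReal (g x)) =
      μ.withDensity (fun x => ENNReal.ofReal (-g x)) := by
    refine Measure.ext_of_charFun ?_
    funext t
    rw [hint g hg, hint (fun x => -g x) hg.neg, ← sub_eq_zero,
      ← integral_sub (hi g hg _) (hi (fun x => -g x) hg.neg _)]
    rw [← h (-(t / (2 * Real.pi)))]
    refine integral_congr_ae (Eventually.of_forall fun x => ?_)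
    simp only
    rw [← sub_mul, ← Complex.ofReal_sub]
    congr 2
    rcases le_total (g x) 0 with h | h <;> simp [h]
  rw [withDensity_eq_iff (hm g hg) (hm (fun x => -g x) hg.neg)] at heq
  · filter_upwards [heq] with x hx
    rcases le_total (g x) 0 with h | h
    · rw [ENNReal.ofReal_of_nonpos h] at hx
      have := ENNReal.ofReal_eq_zero.1 hx.symm
      simp only [Pi.zero_apply]
      linarith
    · rw [ENNReal.ofReal_of_nonpos (by linarith : -g x ≤ 0)] at hx
      have := ENNReal.ofReal_eq_zero.1 hx
      simp only [Pi.zero_apply]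
      linarith
  · rw [← lt_top_iff_ne_top]
    exact hg.lintegral_lt_top

theorem ae_eq_zero_of_integral_mul_expFun_eq_zero {f : ℝ → ℂ} (hf : Integrable f μ)
    (h : ∀ t, ∫ x, f x * expFun t x ∂μ = 0) : f =ᵐ[μ] 0 := by
  have hi : ∀ t, Integrable (fun x => f x * expFun t x) μ := fun t =>
    hf.mul_bdd (c := 1) (continuous_expFun t).aestronglyMeasurable
      (Eventually.of_forall fun x => (norm_expFun t x).le)
  -- Conjugating at `-t` shows that `conj f` also annihilates every exponential, hence so do the
  -- real and imaginary parts of `f`.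
  have hc : ∀ t, ∫ x, conj (f x * expFun (-t) x) ∂μ = 0 := by
    intro t
    rw [integral_conj, h, map_zero]
  have hci : ∀ t, Integrable (fun x => conj (f x * expFun (-t) x)) μ := fun t =>
    (Complex.conjLIE.toContinuousLinearEquiv.toContinuousLinearMap.integrable_comp (hi (-t)))
  have hre := ae_eq_zero_of_integral_ofReal_mul_expFun_eq_zero (g := fun x => (f x).re) hf.re
    (fun t => by
      have := integral_add (hi t) (hci t)
      rw [h, hc, add_zero] at this
      rw [← mul_right_inj' (two_ne_zero (α := ℂ)), mul_zero, ← this, ← integral_const_mul]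
      refine integral_congr_ae (Eventually.of_forall fun x => ?_)
      simp only [map_mul, conj_expFun, neg_neg]
      rw [← add_mul, Complex.add_conj]
      push_cast
      ring)
  have him := ae_eq_zero_of_integral_ofReal_mul_expFun_eq_zero (g := fun x => (f x).im) hf.im
    (fun t => by
      have := integral_sub (hi t) (hci t)
      rw [h, hc, sub_zero] at this
      rw [← mul_right_inj' (mul_ne_zero (two_ne_zero (α := ℂ)) Complex.I_ne_zero), mul_zero,
        ← this, ← integral_const_mul]
      refine integral_congr_ae (Eventually.of_forall fun x => ?_)
      simp only [map_mul, conj_expFun, neg_neg]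
      rw [← sub_mul, Complex.sub_conj]
      push_cast
      ring)
  filter_upwards [hre, him] with x h1 h2
  exact Complex.ext h1 h2

/-- The exponentials span a dense subspace of `L²(μ)`. -/
theorem topologicalClosure_span_range_expL2 [IsFiniteMeasure μ] :
    (Submodule.span ℂ (Set.range (expL2 μ))).topologicalClosure = ⊤ := by
  rw [Submodule.topologicalClosure_eq_top_iff, Submodule.eq_bot_iff]
  intro f hf
  rw [Lp.eq_zero_iff_ae_eq_zero]
  refine ae_eq_zero_of_integral_mul_expFun_eq_zero ((Lp.memLp f).integrable (by norm_num)) ?_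
  intro t
  have h := (Submodule.mem_orthogonal _ _).1 hf (expL2 μ (-t))
    (Submodule.subset_span ⟨_, rfl⟩)
  rw [L2.inner_def] at h
  rw [← h]
  refine integral_congr_ae ?_
  filter_upwards [(memLp_expFun μ (-t)).coeFn_toLp] with x h1
  rw [expL2, h1, RCLike.inner_apply, conj_expFun, neg_neg]

end Density

/-! ### Equality in Bessel's inequality. -/

section Bessel

/-- A vector for which Bessel's inequality is an equality lies in the closed span. -/
theorem mem_topologicalClosure_span_of_one_le_tsum {E ι : Type*} [NormedAddCommGroup E]
    [InnerProductSpace ℂ E] [CompleteSpace E] {v : ι → E} (hv : Orthonormal ℂ v) {x : E}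
    (hx : ‖x‖ = 1) (h : 1 ≤ ∑' i, ‖inner ℂ (v i) x‖ ^ 2) :
    x ∈ (Submodule.span ℂ (Set.range v)).topologicalClosure := by
  set U := (Submodule.span ℂ (Set.range v)).topologicalClosure
  have hvU : ∀ i, v i ∈ U := fun i =>
    Submodule.le_topologicalClosure _ (Submodule.subset_span ⟨i, rfl⟩)
  have hcomp : CompleteSpace U :=
    (Submodule.isClosed_topologicalClosure _).completeSpace_coe
  rw [Submodule.mem_iff_norm_starProjection]
  refine le_antisymm (U.norm_starProjection_apply_le x) ?_
  -- The projection of `x` has the same inner products with the `v i` as `x`, so Bessel's inequality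
  -- for it bounds its norm below by `1`.
  have h1 := hv.tsum_inner_products_le (U.starProjection x)
  simp_rw [← U.inner_starProjection_left_eq_right,
    fun i => Submodule.starProjection_eq_self_iff.2 (hvU i)] at h1
  rw [hx]
  nlinarith [norm_nonneg (U.starProjection x)]

end Bessel

/-! ### Finite prefixes of infinite words. -/

section Prefix

variable {q : ℕ}

/-- The first `n` letters of an infinite word. -/
def pre (σ : ℕ → Fin q) (n : ℕ) : List (Fin q) := (List.range n).map σ

@[simp] theorem length_pre (σ : ℕ → Fin q) (n : ℕ) : (pre σ n).length = n := by simp [pre]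

theorem pre_succ (σ : ℕ → Fin q) (n : ℕ) : pre σ (n + 1) = pre σ n ++ [σ n] := by
  simp [pre, List.range_succ]

theorem take_pre (σ : ℕ → Fin q) {k n : ℕ} (h : k ≤ n) : (pre σ n).take k = pre σ k := by
  rw [pre, ← List.map_take, List.take_range, min_eq_left h, pre]

theorem pre_congr {σ σ' : ℕ → Fin q} {n : ℕ} (h : ∀ k < n, σ k = σ' k) : pre σ n = pre σ' n :=
  List.map_congr_left fun k hk => h k (List.mem_range.1 hk)

theorem pre_length_append_singleton_iff (σ : ℕ → Fin q) (δ : List (Fin q)) (j : Fin q) :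
    pre σ (δ ++ [j]).length = δ ++ [j] ↔ pre σ δ.length = δ ∧ σ δ.length = j := by
  rw [List.length_append, List.length_singleton, pre_succ]
  constructor
  · intro h
    obtain ⟨h1, h2⟩ := List.append_inj h (length_pre σ _)
    exact ⟨h1, List.singleton_injective h2⟩
  · rintro ⟨h1, h2⟩
    rw [h1, h2]

variable [NeZero q]

/-- The infinite word `δ000⋯`. -/
def extend (δ : List (Fin q)) (n : ℕ) : Fin q := δ.getD n 0

theorem pre_extend (δ : List (Fin q)) (n : ℕ) : pre (extend δ) n = trunc δ n := by
  refine List.ext_getElem ?_ fun i h1 h2 => ?_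
  · simp only [length_pre, trunc, List.length_append, List.length_take, List.length_replicate]
    omega
  · simp only [pre, List.getElem_map, List.getElem_range, trunc, extend, List.getElem_append]
    split_ifs with h
    · simp only [List.length_take, lt_min_iff] at h
      rw [List.getElem_take, List.getD_eq_getElem _ _ h.2]
    · simp only [length_pre] at h1
      rw [List.getElem_replicate, List.getD_eq_default]
      simp only [List.length_take, lt_min_iff, not_and, not_lt] at h
      exact h h1

theorem pre_extend_append (δ δ' : List (Fin q)) (m : ℕ) :
    pre (extend (δ ++ δ')) (δ.length + m) = δ ++ trunc δ' m := by
  rw [pre_extend, trunc, trunc, List.take_length_add_append, List.length_append,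
    Nat.add_sub_add_left, List.append_assoc]

theorem trunc_zero (δ : List (Fin q)) : trunc δ 0 = [] := by simp [trunc]

theorem append_trunc_succ (δ δ' : List (Fin q)) (m : ℕ) :
    δ ++ trunc δ' (m + 1) = (δ ++ trunc δ' m) ++ [extend δ' m] := by
  rw [← pre_extend, pre_succ, pre_extend, List.append_assoc]

theorem trunc_length_add (δ : List (Fin q)) (k : ℕ) :
    trunc δ (δ.length + k) = δ ++ List.replicate k 0 := by
  simp [trunc, List.take_of_length_le]

theorem pre_extend_length (δ : List (Fin q)) : pre (extend δ) δ.length = δ := by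
  have := trunc_length_add δ 0
  rw [pre_extend]
  simpa using this

end Prefix

/-! ### Total weight of a set of words through a node. -/

section Mass

variable {q : ℕ} {R : Set (ℕ → Fin q)} {w : (ℕ → Fin q) → ℝ}

open scoped Classical in
/-- The total weight of the words of `R` that begin with `δ`. -/
def mass (R : Set (ℕ → Fin q)) (w : (ℕ → Fin q) → ℝ) (δ : List (Fin q)) : ℝ :=
  ∑' σ : R, if pre (σ : ℕ → Fin q) δ.length = δ then w σ else 0

open scoped Classical in
theorem summable_ite_pre (hs : Summable fun σ : R => w σ) (hw : ∀ σ, 0 ≤ w σ)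
    (δ : List (Fin q)) :
    Summable fun σ : R => if pre (σ : ℕ → Fin q) δ.length = δ then w σ else 0 := by
  refine Summable.of_nonneg_of_le (fun σ => ?_) (fun σ => ?_) hs
  · split_ifs
    exacts [hw _, le_rfl]
  · split_ifs
    exacts [le_rfl, hw _]

theorem mass_eq_sum (hs : Summable fun σ : R => w σ) (hw : ∀ σ, 0 ≤ w σ) (δ : List (Fin q)) :
    mass R w δ = ∑ j, mass R w (δ ++ [j]) := by
  classical
  unfold mass
  rw [← Summable.tsum_finsetSum fun j _ => summable_ite_pre hs hw (δ ++ [j])]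
  refine tsum_congr fun σ => ?_
  simp_rw [pre_length_append_singleton_iff, ite_and]
  split_ifs <;> simp

theorem le_mass (hs : Summable fun σ : R => w σ) (hw : ∀ σ, 0 ≤ w σ) {σ : ℕ → Fin q}
    (hσ : σ ∈ R) (n : ℕ) : w σ ≤ mass R w (pre σ n) := by
  classical
  have h := (summable_ite_pre hs hw (pre σ n)).le_tsum ⟨σ, hσ⟩ fun σ' _ => by
    split_ifs
    exacts [hw _, le_rfl]
  simpa [mass] using h

theorem mass_nil : mass R w [] = ∑' σ : R, w σ := by simp [mass, pre]

end Mass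

/-! ### The zero-one law on the tree. -/

section Bootstrap

variable {q : ℕ} {R : Set (ℕ → Fin q)} {w : (ℕ → Fin q) → ℝ} {p W : List (Fin q) → ℝ}

/-- The mass leaving the path `σ` between levels `n` and `n + k` sits on siblings of the path, and
the deficit hypothesis applies at each of them. -/
theorem sub_le_sub_add_of_deficit {N : ℕ} {r : ℝ}
    (hp : ∀ δ, p δ = ∑ j, p (δ ++ [j])) (hW : ∀ δ, W δ = ∑ j, W (δ ++ [j]))
    (hr : ∀ δ, N ≤ δ.length → p δ ≤ W δ + r * p δ) (σ : ℕ → Fin q) {n : ℕ} (hn : N ≤ n)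
    (k : ℕ) : p (pre σ n) - p (pre σ (n + k)) ≤
      W (pre σ n) - W (pre σ (n + k)) + r * (p (pre σ n) - p (pre σ (n + k))) := by
  induction k with
  | zero => simp
  | succ k ih =>
    have h1 := hp (pre σ (n + k))
    have h2 := hW (pre σ (n + k))
    rw [← Finset.add_sum_erase _ _ (Finset.mem_univ (σ (n + k))), ← pre_succ] at h1 h2
    have h3 : ∑ j ∈ Finset.univ.erase (σ (n + k)), p (pre σ (n + k) ++ [j]) ≤
        ∑ j ∈ Finset.univ.erase (σ (n + k)), W (pre σ (n + k) ++ [j]) +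
        r * ∑ j ∈ Finset.univ.erase (σ (n + k)), p (pre σ (n + k) ++ [j]) := by
      rw [Finset.mul_sum, ← Finset.sum_add_distrib]
      refine Finset.sum_le_sum fun j _ => hr _ ?_
      simp only [List.length_append, length_pre]
      omega
    rw [← add_assoc]
    have h4 : p (pre σ (n + k)) - p (pre σ (n + k + 1)) =
      ∑ j ∈ Finset.univ.erase (σ (n + k)), p (pre σ (n + k) ++ [j]) := by linarith
    rw [← h4] at h3
    linarith

/-- The tree form of Lévy's zero-one law: a Markov chain on words which, from each node that
satisfies `Nz`, follows some word of `R` with conditional probability at least `c`, almost surely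
ends in `R`. -/
theorem le_of_uniform_escape [NeZero q] {N : ℕ} {c : ℝ} (hc0 : 0 < c) (hc1 : c ≤ 1)
    (hp : ∀ δ, p δ = ∑ j, p (δ ++ [j])) (hW : ∀ δ, W δ = ∑ j, W (δ ++ [j]))
    (hW0 : ∀ δ, 0 ≤ W δ)
    (hlim : ∀ σ ∈ R, Tendsto (fun n => p (pre σ n)) atTop (𝓝 (w σ)))
    (hwW : ∀ σ ∈ R, ∀ n, w σ ≤ W (pre σ n)) {Nz : List (Fin q) → Prop}
    (hNz : ∀ δ, N ≤ δ.length → Nz δ →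
      ∃ σ ∈ R, pre σ δ.length = δ ∧ c * p δ ≤ w σ)
    (hzero : ∀ δ, N ≤ δ.length → (∀ k, ¬ Nz (δ ++ List.replicate k 0)) →
      ∃ σ ∈ R, pre σ δ.length = δ ∧ c * p δ ≤ w σ)
    (hchild : ∀ δ (j : Fin q), j ≠ 0 → Nz (δ ++ [j])) : p [] ≤ W [] := by
  -- The deficit `p - W` is the mass not ending in `R`. The mass `w σ ≥ c * p δ` that never leaves
  -- `σ` has none, so a relative deficit `r` improves to `r * (1 - c)`.
  have hgood : ∀ r : ℝ, 0 ≤ r → (∀ δ, N ≤ δ.length → p δ ≤ W δ + r * p δ) →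
      ∀ δ, N ≤ δ.length → (∃ σ ∈ R, pre σ δ.length = δ ∧ c * p δ ≤ w σ) →
      p δ ≤ W δ + r * (1 - c) * p δ := by
    rintro r hr0 hr δ hδ ⟨σ, hσ, hpre, hcw⟩
    have h1 : ∀ k, p δ - p (pre σ (δ.length + k)) ≤
        W δ - w σ + r * (p δ - p (pre σ (δ.length + k))) := by
      intro k
      have h2 := sub_le_sub_add_of_deficit hp hW hr σ hδ k
      rw [hpre] at h2
      linarith [hwW σ hσ (δ.length + k)]
    have hl : Tendsto (fun k => p (pre σ (δ.length + k))) atTop (𝓝 (w σ)) := by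
      have := (tendsto_add_atTop_iff_nat δ.length).2 (hlim σ hσ)
      simpa only [add_comm] using this
    have h3 : p δ - w σ ≤ W δ - w σ + r * (p δ - w σ) :=
      le_of_tendsto_of_tendsto' (hl.const_sub _)
        (((hl.const_sub (p δ)).const_mul r).const_add _) h1
    nlinarith
  have hstep : ∀ r : ℝ, 0 ≤ r → (∀ δ, N ≤ δ.length → p δ ≤ W δ + r * p δ) →
      ∀ δ, N ≤ δ.length → p δ ≤ W δ + r * (1 - c) * p δ := by
    intro r hr0 hr δ hδ
    by_cases hall : ∀ k, ¬ Nz (δ ++ List.replicate k 0)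
    · exact hgood r hr0 hr δ hδ (hzero δ hδ hall)
    · push Not at hall
      obtain ⟨K, hK⟩ := hall
      -- Pass to the children: those with nonzero letter satisfy `Nz` at once, and the zero child
      -- needs one zero fewer to reach `Nz`.
      induction K generalizing δ with
      | zero => exact hgood r hr0 hr δ hδ (hNz δ hδ (by simpa using hK))
      | succ K ih =>
        have hlen : ∀ j : Fin q, N ≤ (δ ++ [j]).length := fun j => by
          rw [List.length_append]; omega
        have hj : ∀ j : Fin q, p (δ ++ [j]) ≤
            W (δ ++ [j]) + r * (1 - c) * p (δ ++ [j]) := by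
          intro j
          by_cases hj : j = 0
          · subst hj
            refine ih _ (hlen 0) ?_
            rwa [List.append_assoc, List.singleton_append, ← List.replicate_succ]
          · exact hgood r hr0 hr _ (hlen j) (hNz _ (hlen j) (hchild δ j hj))
        rw [hp δ, hW δ, Finset.mul_sum, ← Finset.sum_add_distrib]
        exact Finset.sum_le_sum fun j _ => hj j
  have hpow : ∀ k : ℕ, ∀ δ, N ≤ δ.length → p δ ≤ W δ + (1 - c) ^ k * p δ := by
    intro k
    induction k with
    | zero =>
      intro δ _
      rw [pow_zero, one_mul]
      linarith [hW0 δ]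
    | succ k ih =>
      intro δ hδ
      rw [pow_succ]
      exact hstep _ (pow_nonneg (by linarith) _) ih δ hδ
  have hlevel : ∀ δ, N ≤ δ.length → p δ ≤ W δ := by
    intro δ hδ
    have hl : Tendsto (fun k : ℕ => W δ + (1 - c) ^ k * p δ) atTop (𝓝 (W δ + 0 * p δ)) :=
      ((tendsto_pow_atTop_nhds_zero_of_lt_one (by linarith) (by linarith)).mul_const
        (p δ)).const_add _
    have := ge_of_tendsto' hl fun k => hpow k δ hδ
    linarith
  -- Both `p` and `W` are additive over children, so the inequality at depth `N` propagates back to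
  -- the root.
  have hdown : ∀ d : ℕ, ∀ δ, N ≤ δ.length + d → p δ ≤ W δ := by
    intro d
    induction d with
    | zero => exact hlevel
    | succ d ih =>
      intro δ hδ
      rw [hp δ, hW δ]
      refine Finset.sum_le_sum fun j _ => ih _ ?_
      rw [List.length_append, List.length_singleton]
      omega
  exact hdown N [] (by simp)

end Bootstrap

/-! ### The random walk driven by the mask. -/

section Walk

variable {q b : ℕ} {τ : List (Fin q) → ℤ} {ξ : ℝ}

/-- The partial sum `∑ τ(δ|ₖ) bᵏ⁻¹` over the nonempty prefixes of `δ`. -/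
def labelSum (b : ℕ) (τ : List (Fin q) → ℤ) (δ : List (Fin q)) : ℝ :=
  ∑ k ∈ Finset.range δ.length, (τ (δ.take (k + 1)) : ℝ) * (b : ℝ) ^ k

/-- The frequency `ξ + labelSum b τ δ`, rescaled to the level of `δ`. -/
def state (b : ℕ) (τ : List (Fin q) → ℤ) (ξ : ℝ) (δ : List (Fin q)) : ℝ :=
  (ξ + labelSum b τ δ) / (b : ℝ) ^ δ.length

/-- The probability that the random walk on words with transition probabilities
`|mask (state δ + τ (δj))|²` visits `δ`. -/
def weight (b : ℕ) (τ : List (Fin q) → ℤ) (ξ : ℝ) (δ : List (Fin q)) : ℝ :=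
  ∏ k ∈ Finset.range δ.length, ‖mask q (state b τ ξ (δ.take k) + τ (δ.take (k + 1)))‖ ^ 2

theorem labelSum_append_singleton (δ : List (Fin q)) (j : Fin q) :
    labelSum b τ (δ ++ [j]) = labelSum b τ δ + τ (δ ++ [j]) * (b : ℝ) ^ δ.length := by
  rw [labelSum, List.length_append, List.length_singleton, Finset.sum_range_succ, labelSum]
  congr 1
  · refine Finset.sum_congr rfl fun k hk => ?_
    rw [List.take_append_of_le_length (Finset.mem_range.1 hk)]
  · rw [List.take_of_length_le (by simp)]

theorem weight_append_singleton (δ : List (Fin q)) (j : Fin q) :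
    weight b τ ξ (δ ++ [j]) =
      weight b τ ξ δ * ‖mask q (state b τ ξ δ + τ (δ ++ [j]))‖ ^ 2 := by
  rw [weight, List.length_append, List.length_singleton, Finset.prod_range_succ, weight]
  congr 1
  · refine Finset.prod_congr rfl fun k hk => ?_
    have hk' := Finset.mem_range.1 hk
    rw [List.take_append_of_le_length hk', List.take_append_of_le_length hk'.le]
  · rw [List.take_left, List.take_of_length_le (by simp)]

theorem weight_nonneg (δ : List (Fin q)) : 0 ≤ weight b τ ξ δ :=
  Finset.prod_nonneg fun _ _ => by positivity

@[simp] theorem weight_nil : weight b τ ξ [] = 1 := by simp [weight]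

theorem state_append_singleton (hb : 0 < b) (δ : List (Fin q)) (j : Fin q) :
    state b τ ξ (δ ++ [j]) = (state b τ ξ δ + τ (δ ++ [j])) / b := by
  have : (b : ℝ) ≠ 0 := by positivity
  rw [state, state, labelSum_append_singleton, List.length_append, List.length_singleton, pow_succ]
  field_simp
  ring

variable [NeZero q]

theorem IsTreeMapping.congr_append (hτ : IsTreeMapping b τ) (δ : List (Fin q)) (j : Fin q) :
    τ (δ ++ [j]) ≡ ((j : ℕ) : ℤ) [ZMOD q] := by
  simpa using hτ.congr (δ ++ [j]) (by simp)

theorem IsTreeMapping.label_ne_zero (hτ : IsTreeMapping b τ) (δ : List (Fin q)) {j : Fin q}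
    (hj : j ≠ 0) : τ (δ ++ [j]) ≠ 0 := by
  intro h
  have h1 := hτ.congr_append δ j
  rw [h] at h1
  have h2 := Int.modEq_zero_iff_dvd.1 h1.symm
  have h3 := Int.eq_zero_of_dvd_of_nonneg_of_lt (by positivity) (by exact_mod_cast j.2) h2
  refine hj (Fin.ext ?_)
  simpa using h3

theorem weight_eq_sum (hτ : IsTreeMapping b τ) (δ : List (Fin q)) :
    weight b τ ξ δ = ∑ j, weight b τ ξ (δ ++ [j]) := by
  simp_rw [weight_append_singleton]
  rw [← Finset.mul_sum]
  have : ∀ j : Fin q, mask q (state b τ ξ δ + τ (δ ++ [j])) =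
      mask q (state b τ ξ δ + (j : ℕ)) := fun j => by
    rw [mask_add_congr _ (hτ.congr_append δ j)]
    simp
  simp_rw [this]
  rw [sum_norm_mask_add_nat_sq, mul_one]

/-- The free integer `z` carries the induction: removing the last letter turns it into `τ (δ ++ [j])
+ b * z`, of which the mask sees only the label because `q ∣ b`. -/
theorem norm_cantorFourier_sq_eq_weight_mul (hb : 1 < b) (hdvd : q ∣ b) (δ : List (Fin q))
    (z : ℤ) : ‖cantorFourier q b (ξ + labelSum b τ δ + b ^ δ.length * z)‖ ^ 2 =
      weight b τ ξ δ * ‖cantorFourier q b (state b τ ξ δ + z)‖ ^ 2 := by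
  have hb0 : (b : ℝ) ≠ 0 := by positivity
  induction δ using List.reverseRecOn generalizing z with
  | nil => simp [state]
  | append_singleton δ j ih =>
    have h1 : ξ + labelSum b τ (δ ++ [j]) + b ^ (δ ++ [j]).length * (z : ℝ) =
        ξ + labelSum b τ δ + b ^ δ.length * ((τ (δ ++ [j]) + b * z : ℤ) : ℝ) := by
      rw [labelSum_append_singleton, List.length_append, List.length_singleton, pow_succ]
      push_cast
      ring
    have h2 : (state b τ ξ δ + ((τ (δ ++ [j]) + b * z : ℤ) : ℝ)) / b =
        state b τ ξ (δ ++ [j]) + z := by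
      rw [state_append_singleton (by omega)]
      push_cast
      field_simp
      ring
    have h3 : τ (δ ++ [j]) + b * z ≡ τ (δ ++ [j]) [ZMOD q] :=
      (Int.emod_emod_of_dvd _ (dvd_refl _)).symm.trans (by
        obtain ⟨r, rfl⟩ := hdvd
        push_cast
        rw [mul_assoc]
        simp)
    rw [h1, ih, cantorFourier_eq_mask_mul hb, h2, weight_append_singleton,
      mask_add_congr _ h3, norm_mul, mul_pow, mul_assoc]

theorem weight_mul_norm_le (δ : List (Fin q)) :
    weight b τ ξ δ * ‖cantorFourier q b (state b τ ξ δ)‖ ^ 2 ≤ weight b τ ξ δ :=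
  mul_le_of_le_one_right (weight_nonneg δ)
    (pow_le_one₀ (norm_nonneg _) (norm_cantorFourier_le_one _))

end Walk

/-! ### Regular words, their frequencies and orthogonality. -/

section Regular

variable {q b : ℕ} {τ : List (Fin q) → ℤ} {ξ : ℝ}

/-- The infinite words with eventually vanishing labels. -/
def regularSeq (τ : List (Fin q) → ℤ) : Set (ℕ → Fin q) := {σ | ∀ᶠ n in atTop, τ (pre σ n) = 0}

/-- The frequency `∑ τ(σ|ₙ) bⁿ⁻¹` of an infinite word. -/
def frequency (b : ℕ) (τ : List (Fin q) → ℤ) (σ : ℕ → Fin q) : ℝ :=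
  ∑' n : ℕ, (τ (pre σ (n + 1)) : ℝ) * (b : ℝ) ^ n

theorem labelSum_pre (σ : ℕ → Fin q) (n : ℕ) : labelSum b τ (pre σ n) =
    ∑ k ∈ Finset.range n, (τ (pre σ (k + 1)) : ℝ) * (b : ℝ) ^ k := by
  rw [labelSum, length_pre]
  exact Finset.sum_congr rfl fun k hk => by rw [take_pre σ (Finset.mem_range.1 hk)]

theorem frequency_eq_labelSum {σ : ℕ → Fin q} {n : ℕ} (h : ∀ m, n ≤ m → τ (pre σ (m + 1)) = 0) :
    frequency b τ σ = labelSum b τ (pre σ n) := by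
  rw [labelSum_pre]
  refine tsum_eq_sum fun m hm => ?_
  rw [h m (by simpa using hm), Int.cast_zero, zero_mul]

theorem exists_frequency_eq {σ : ℕ → Fin q} (hσ : σ ∈ regularSeq τ) :
    ∃ N, ∀ n, N ≤ n → frequency b τ σ = labelSum b τ (pre σ n) := by
  obtain ⟨N, hN⟩ := eventually_atTop.1 hσ
  exact ⟨N, fun n hn => frequency_eq_labelSum fun m hm => hN _ (by omega)⟩

theorem exists_labelSum_pre_add (σ : ℕ → Fin q) (n k : ℕ) :
    ∃ z : ℤ, labelSum b τ (pre σ (n + k)) = labelSum b τ (pre σ n) + (b : ℝ) ^ n * z := by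
  induction k with
  | zero => exact ⟨0, by simp⟩
  | succ k ih =>
    obtain ⟨z, hz⟩ := ih
    refine ⟨z + τ (pre σ (n + k + 1)) * b ^ k, ?_⟩
    rw [← add_assoc, pre_succ, labelSum_append_singleton, hz, length_pre, pow_add]
    push_cast
    ring

theorem exists_frequency_eq_labelSum_add {σ : ℕ → Fin q} (hσ : σ ∈ regularSeq τ) (n : ℕ) :
    ∃ z : ℤ, frequency b τ σ = labelSum b τ (pre σ n) + (b : ℝ) ^ n * z := by
  obtain ⟨N, hN⟩ := exists_frequency_eq (b := b) hσ
  rw [hN (n + N) (by omega)]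
  exact exists_labelSum_pre_add σ n N

variable [NeZero q]

theorem extend_mem_regularSeq_iff {δ : List (Fin q)} :
    extend δ ∈ regularSeq τ ↔ IsRegular τ δ := by
  simp only [regularSeq, Set.mem_ofPred_eq, pre_extend, IsRegular]

/-- A nonzero letter forces a nonzero label, so a word with eventually vanishing labels ends in
zeros and is recovered from a finite prefix by `extend`. -/
theorem spectrumSet_eq_image (hτ : IsTreeMapping b τ) :
    spectrumSet b τ = frequency b τ '' regularSeq τ := by
  ext x
  constructor
  · rintro ⟨δ, -, hδ, rfl⟩
    refine ⟨extend δ, extend_mem_regularSeq_iff.2 hδ, ?_⟩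
    simp only [frequency, pre_extend]
  · rintro ⟨σ, hσ, rfl⟩
    obtain ⟨N, hN⟩ := eventually_atTop.1 hσ
    have hext : extend (pre σ (N + 1)) = σ := by
      funext n
      rw [extend]
      rcases lt_or_ge n (N + 1) with h | h
      · rw [List.getD_eq_getElem _ _ (by simpa using h)]
        simp [pre]
      · rw [List.getD_eq_default _ _ (by simpa using h)]
        by_contra hne
        refine hτ.label_ne_zero (pre σ n) (Ne.symm hne) ?_
        rw [← pre_succ]
        exact hN _ (by omega)
    refine ⟨pre σ (N + 1), ?_, ?_, ?_⟩
    · exact List.ne_nil_of_length_pos (by simp)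
    · rw [← extend_mem_regularSeq_iff, hext]
      exact hσ
    · simp only [frequency, ← pre_extend, hext]

theorem norm_cantorFourier_frequency_eventuallyEq (hb : 1 < b) (hdvd : q ∣ b) {σ : ℕ → Fin q}
    (hσ : σ ∈ regularSeq τ) : ∀ᶠ n in atTop,
      ‖cantorFourier q b (ξ + frequency b τ σ)‖ ^ 2 =
        weight b τ ξ (pre σ n) * ‖cantorFourier q b (state b τ ξ (pre σ n))‖ ^ 2 := by
  obtain ⟨N, hN⟩ := exists_frequency_eq (b := b) hσ
  filter_upwards [eventually_ge_atTop N] with n hn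
  have := norm_cantorFourier_sq_eq_weight_mul (ξ := ξ) (τ := τ) hb hdvd (pre σ n) 0
  rw [hN n hn]
  simpa using this

/-- Along a regular word the state tends to `0`, so the factor `|μ̂(state)|²` separating the weight
from the limit tends to `1`. -/
theorem tendsto_weight_pre (hb : 1 < b) (hdvd : q ∣ b) {σ : ℕ → Fin q}
    (hσ : σ ∈ regularSeq τ) : Tendsto (fun n => weight b τ ξ (pre σ n)) atTop
      (𝓝 (‖cantorFourier q b (ξ + frequency b τ σ)‖ ^ 2)) := by
  obtain ⟨N, hN⟩ := exists_frequency_eq (b := b) hσ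
  have h0 : Tendsto (fun n : ℕ => (ξ + frequency b τ σ) / (b : ℝ) ^ n) atTop (𝓝 0) :=
    tendsto_const_nhds.div_atTop (tendsto_pow_atTop_atTop_of_one_lt (by exact_mod_cast hb))
  have h1 : Tendsto (fun n => state b τ ξ (pre σ n)) atTop (𝓝 0) := by
    refine h0.congr' ?_
    filter_upwards [eventually_ge_atTop N] with n hn
    rw [state, hN n hn, length_pre]
  have h2 : Tendsto (fun n => ‖cantorFourier q b (state b τ ξ (pre σ n))‖ ^ 2) atTop (𝓝 1) := by
    have := (((continuous_cantorFourier (q := q) (b := b)).norm.tendsto 0).comp h1).pow 2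
    simpa using this
  have h3 : Tendsto (fun n => ‖cantorFourier q b (ξ + frequency b τ σ)‖ ^ 2 /
      ‖cantorFourier q b (state b τ ξ (pre σ n))‖ ^ 2) atTop
      (𝓝 (‖cantorFourier q b (ξ + frequency b τ σ)‖ ^ 2 / 1)) :=
    tendsto_const_nhds.div h2 one_ne_zero
  rw [div_one] at h3
  refine h3.congr' ?_
  filter_upwards [norm_cantorFourier_frequency_eventuallyEq (ξ := ξ) hb hdvd hσ,
    h2.eventually (lt_mem_nhds one_pos)] with n hn hpos
  rw [hn, mul_div_cancel_right₀ _ hpos.ne']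

theorem cantorFourier_frequency_sub_eq_zero (hb : 1 < b) (hdvd : q ∣ b)
    (hτ : IsTreeMapping b τ) {σ σ' : ℕ → Fin q} (hσ : σ ∈ regularSeq τ) (hσ' : σ' ∈ regularSeq τ)
    (hne : σ ≠ σ') : cantorFourier q b (frequency b τ σ - frequency b τ σ') = 0 := by
  classical
  have hb0 : (b : ℝ) ≠ 0 := by positivity
  have hex : ∃ k, σ k ≠ σ' k := Function.ne_iff.1 hne
  set k := Nat.find hex with hk
  have hkne : σ k ≠ σ' k := Nat.find_spec hex
  have hpre : pre σ k = pre σ' k :=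
    pre_congr fun i hi => not_not.1 (Nat.find_min hex hi)
  obtain ⟨z, hz⟩ := exists_frequency_eq_labelSum_add (b := b) hσ (k + 1)
  obtain ⟨z', hz'⟩ := exists_frequency_eq_labelSum_add (b := b) hσ' (k + 1)
  -- Labels beyond the first disagreement contribute only a multiple of `b`, hence of `q`, so `m` is
  -- the difference of two distinct letters mod `q`.
  set m : ℤ := τ (pre σ k ++ [σ k]) - τ (pre σ k ++ [σ' k]) + b * (z - z') with hm
  have hdiff : (frequency b τ σ - frequency b τ σ') / (b : ℝ) ^ k = m := by
    rw [div_eq_iff (pow_ne_zero _ hb0), hz, hz', pre_succ, pre_succ, labelSum_append_singleton,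
      labelSum_append_singleton, ← hpre, length_pre, hm, pow_succ]
    push_cast
    ring
  have hmne : ¬ (q : ℤ) ∣ m := by
    intro hdm
    have h1 : (q : ℤ) ∣ τ (pre σ k ++ [σ k]) - τ (pre σ k ++ [σ' k]) := by
      have h2 : (q : ℤ) ∣ b * (z - z') := (Int.natCast_dvd_natCast.2 hdvd).mul_right _
      exact (dvd_add_left h2).1 hdm
    have h3 : ((σ k : ℕ) : ℤ) ≡ ((σ' k : ℕ) : ℤ) [ZMOD q] :=
      (hτ.congr_append _ _).symm.trans
        ((Int.modEq_iff_dvd.2 h1).symm.trans (hτ.congr_append _ _))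
    have h4 : (σ k : ℕ) ≡ σ' k [MOD q] := Int.natCast_modEq_iff.1 h3
    exact hkne (Fin.ext (h4.eq_of_lt_of_lt (σ k).2 (σ' k).2))
  rw [cantorFourier_eq_prod_mul hb _ (k + 1), Finset.prod_range_succ, hdiff,
    mask_int_eq_zero hmne, mul_zero, zero_mul]

end Regular

/-! ### Bounds for the state. -/

section StateBounds

variable {q b : ℕ} [NeZero q] {τ : List (Fin q) → ℤ} {ξ : ℝ}

/-- The endpoints are the fixed points of `y ↦ (y - 1) / b` and `y ↦ (y + b - 2) / b`, given by the
extreme labels. The error from `ξ` contracts by `b` at each level. -/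
theorem state_mem_Icc (hb : 1 < b) (hτ : IsTreeMapping b τ) (δ : List (Fin q)) :
    -(1 / ((b : ℝ) - 1)) - |ξ| / b ^ δ.length ≤ state b τ ξ δ ∧
      state b τ ξ δ ≤ 1 - 1 / ((b : ℝ) - 1) + |ξ| / b ^ δ.length := by
  have hb' : (1 : ℝ) < b := by exact_mod_cast hb
  have hb0 : (0 : ℝ) < b := by linarith
  have hinv : 1 / ((b : ℝ) - 1) * (b - 1) = 1 := by
    rw [one_div, inv_mul_cancel₀ (by linarith)]
  induction δ using List.reverseRecOn with
  | nil =>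
    have hb2 : (2 : ℝ) ≤ b := by exact_mod_cast hb
    have h1 : 0 < 1 / ((b : ℝ) - 1) := by
      have : 0 < (b : ℝ) - 1 := by linarith
      positivity
    have h2 : 1 / ((b : ℝ) - 1) ≤ 1 := by
      rw [div_le_one (by linarith)]
      linarith
    simp only [state, labelSum, List.length_nil, Finset.range_zero, Finset.sum_empty, pow_zero,
      div_one, add_zero]
    constructor
    · linarith [neg_abs_le ξ]
    · linarith [le_abs_self ξ]
  | append_singleton δ j ih =>
    obtain ⟨h1, h2⟩ := hτ.range (δ ++ [j]) (by simp)
    have h1' : (-1 : ℝ) ≤ τ (δ ++ [j]) := by exact_mod_cast h1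
    have h2' : (τ (δ ++ [j]) : ℝ) ≤ b - 2 := by exact_mod_cast h2
    rw [state_append_singleton (by omega), List.length_append, List.length_singleton, pow_succ,
      ← div_div, le_div_iff₀ hb0, div_le_iff₀ hb0, sub_mul, add_mul, div_mul_cancel₀ _ hb0.ne']
    constructor <;> nlinarith [ih.1, ih.2]

theorem exists_state_bounds (hb : 4 ≤ b) (hτ : IsTreeMapping b τ) (ξ : ℝ) :
    ∃ N : ℕ, ∀ δ : List (Fin q), N ≤ δ.length →
      -(1 / 2) ≤ state b τ ξ δ ∧ state b τ ξ δ ≤ 1 - 1 / b := by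
  have hb' : (4 : ℝ) ≤ b := by exact_mod_cast hb
  have h0 : Tendsto (fun n : ℕ => |ξ| / (b : ℝ) ^ n) atTop (𝓝 0) :=
    tendsto_const_nhds.div_atTop (tendsto_pow_atTop_atTop_of_one_lt (by linarith))
  have h1 : 1 / (b : ℝ) < 1 / (b - 1) := one_div_lt_one_div_of_lt (by linarith) (by linarith)
  have h2 : 1 / ((b : ℝ) - 1) ≤ 1 / 3 := one_div_le_one_div_of_le (by norm_num) (by linarith)
  -- The margins are `1 / (b - 1) - 1 / b` on the right and at least `1 / 2 - 1 / 3` on the left.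
  obtain ⟨N, hN⟩ := eventually_atTop.1 ((h0.eventually (gt_mem_nhds (sub_pos.2 h1))).and
    (h0.eventually (gt_mem_nhds (show (0 : ℝ) < 1 / 6 by norm_num))))
  refine ⟨N, fun δ hδ => ?_⟩
  obtain ⟨h3, h4⟩ := state_mem_Icc (ξ := ξ) (by omega) hτ δ
  obtain ⟨h5, h6⟩ := hN _ hδ
  constructor <;> linarith

/-- Before division by `b`, the label `-1` moves the state to at most `-1 / b`, and a positive label
moves it to at least `1 / 2`. -/
theorem le_abs_state_append (hb : 4 ≤ b) (hτ : IsTreeMapping b τ) {δ : List (Fin q)} {j : Fin q}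
    (h1 : -(1 / 2) ≤ state b τ ξ δ) (h2 : state b τ ξ δ ≤ 1 - 1 / b) (hne : τ (δ ++ [j]) ≠ 0) :
    1 / (b : ℝ) ^ 2 ≤ |state b τ ξ (δ ++ [j])| := by
  have hb' : (4 : ℝ) ≤ b := by exact_mod_cast hb
  have hb0 : (0 : ℝ) < b := by linarith
  have hb4 : 1 / (b : ℝ) ≤ 1 / 4 := one_div_le_one_div_of_le (by norm_num) hb'
  rw [state_append_singleton (by omega), abs_div, abs_of_pos hb0, le_div_iff₀ hb0, pow_two,
    ← div_div, div_mul_cancel₀ _ hb0.ne']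
  obtain ⟨h3, -⟩ := hτ.range (δ ++ [j]) (by simp)
  rcases lt_or_gt_of_ne hne with h | h
  · have h4 : τ (δ ++ [j]) = -1 := by omega
    rw [h4, le_abs']
    left
    push_cast
    linarith
  · have h4 : (1 : ℝ) ≤ τ (δ ++ [j]) := by exact_mod_cast h
    rw [le_abs']
    right
    linarith

end StateBounds

/-! ### Level differences as sums of costs per level. -/

section LevelDifference

theorem pred_succ_of_mem {A : Set ℕ} {n : ℕ} (h : n ∈ A) : pred A (n + 1) = n := by
  refine IsGreatest.csSup_eq ⟨⟨Or.inr h, Nat.lt_succ_self n⟩, ?_⟩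
  rintro m ⟨-, hm⟩
  exact Nat.lt_succ_iff.1 hm

theorem pred_succ_of_notMem {A : Set ℕ} {n : ℕ} (h : n ∉ A) (hn : n ≠ 0) :
    pred A (n + 1) = pred A n := by
  have : insert 0 A ∩ Set.Iio (n + 1) = insert 0 A ∩ Set.Iio n := by
    ext m
    simp only [Set.mem_inter_iff, Set.mem_insert_iff, Set.mem_Iio]
    refine and_congr_right fun hm => ⟨fun hlt => ?_, fun hlt => by omega⟩
    refine lt_of_le_of_ne (Nat.lt_succ_iff.1 hlt) ?_
    rintro rfl
    exact hm.elim hn h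
  rw [pred, this, pred]

theorem pred_lt (A : Set ℕ) {n : ℕ} (hn : n ≠ 0) : pred A n < n :=
  (Nat.sSup_mem ⟨0, Or.inl rfl, Nat.pos_of_ne_zero hn⟩
    ⟨n, fun _ hm => le_of_lt hm.2⟩ : pred A n ∈ insert 0 A ∩ Set.Iio n).2

variable {q : ℕ} [NeZero q] {τ : List (Fin q) → ℤ}

open scoped Classical in
/-- The contribution of the level `n` to `levelDiffAt τ δ δ'`. -/
def levelCost (τ : List (Fin q) → ℤ) (δ δ' : List (Fin q)) (n : ℕ) : ℕ :=
  (if n ∈ levelA τ δ δ' then 1 else 0) +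
    if n ∈ levelB τ δ δ' then n - pred (levelA τ δ δ') n - 1 else 0

theorem sum_levelCost_le (δ δ' : List (Fin q)) (s : Finset ℕ) :
    ((∑ n ∈ s, levelCost τ δ δ' n : ℕ) : ℝ≥0∞) ≤ levelDiffAt τ δ δ' := by
  classical
  simp only [levelCost, Finset.sum_add_distrib, Nat.cast_add, levelDiffAt]
  refine add_le_add ?_ ?_
  · rw [← Finset.card_filter, ← ENat.toENNReal_coe, ← Set.encard_coe_eq_coe_finsetCard]
    refine ENat.toENNReal_le.2 (Set.encard_le_encard fun n hn => ?_)
    exact (Finset.mem_filter.1 hn).2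
  · rw [tsum_subtype (levelB τ δ δ')
      (fun n => ((n - pred (levelA τ δ δ') n - 1 : ℕ) : ℝ≥0∞)), Nat.cast_sum]
    refine le_trans (le_of_eq ?_) (ENNReal.sum_le_tsum s)
    refine Finset.sum_congr rfl fun n _ => ?_
    rw [Set.indicator_apply]
    split_ifs <;> simp

theorem finite_levelA {δ δ' : List (Fin q)} {K : ℕ} (h : levelDiffAt τ δ δ' ≤ K) :
    (levelA τ δ δ').Finite := by
  have h1 : ((levelA τ δ δ').encard : ℝ≥0∞) ≤ ((K : ℕ∞) : ℝ≥0∞) :=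
    (le_self_add.trans h).trans (by simp)
  exact Set.finite_of_encard_le_coe (ENat.toENNReal_le.1 h1)

theorem exists_forall_levelDiffAt_le (h : levelDiffSup τ < ⊤) :
    ∃ K : ℕ, ∀ δ : List (Fin q), δ ≠ [] → ∃ δ', levelDiffAt τ δ δ' ≤ K := by
  obtain ⟨K, hK⟩ := ENNReal.exists_nat_gt h.ne
  refine ⟨K, fun δ hδ => ?_⟩
  have h1 : levelDiff τ δ < K :=
    (le_iSup₂ (f := fun (δ : List (Fin q)) (_ : δ ≠ []) => levelDiff τ δ) δ hδ).trans_lt hK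
  obtain ⟨δ', h2⟩ := iInf_lt_iff.1 h1
  obtain ⟨-, h3⟩ := iInf_lt_iff.1 h2
  exact ⟨δ', h3.le⟩

theorem extend_append_mem_regularSeq {δ δ' : List (Fin q)} (h : (levelA τ δ δ').Finite) :
    extend (δ ++ δ') ∈ regularSeq τ := by
  obtain ⟨M, hM⟩ := h.bddAbove
  refine eventually_atTop.2 ⟨δ.length + M + 1, fun n hn => ?_⟩
  obtain ⟨m, rfl⟩ := Nat.exists_eq_add_of_le (show δ.length ≤ n by omega)
  rw [pre_extend_append]
  by_contra hne
  have := hM (show m ∈ levelA τ δ δ' from ⟨by omega, hne⟩)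
  omega

end LevelDifference

/-! ### Loss of potential along a branch. -/

section Potential

variable {q b : ℕ} [NeZero q] {τ : List (Fin q) → ℤ} {ξ : ℝ}

/-- A nonzero label resets the state to size at least `b⁻²`, and each zero label divides it by `b`.
The exponent counts the levels since the last reset, where `h0` makes `δ` itself a reset at level
`0`, in line with `n_0 = 0`. -/
theorem le_abs_state_append_trunc (hb : 4 ≤ b) (hτ : IsTreeMapping b τ) {N : ℕ}
    (hN : ∀ δ : List (Fin q), N ≤ δ.length →
      -(1 / 2) ≤ state b τ ξ δ ∧ state b τ ξ δ ≤ 1 - 1 / b) {δ : List (Fin q)}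
    (hδ : N ≤ δ.length) (h0 : 1 / (b : ℝ) ^ 2 ≤ |state b τ ξ δ|) (δ' : List (Fin q)) (m : ℕ) :
    1 / (b : ℝ) ^ 2 * (1 / b) ^ (m - pred (levelA τ δ δ') (m + 1)) ≤
      |state b τ ξ (δ ++ trunc δ' m)| := by
  have hb0 : (0 : ℝ) < b := by
    have : 0 < b := by omega
    exact_mod_cast this
  induction m with
  | zero => simpa [trunc_zero] using h0
  | succ m ih =>
    obtain ⟨h1, h2⟩ := hN (δ ++ trunc δ' m) (by rw [List.length_append]; omega)
    by_cases hA : m + 1 ∈ levelA τ δ δ'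
    · rw [pred_succ_of_mem hA, Nat.sub_self, pow_zero, mul_one, append_trunc_succ]
      refine le_abs_state_append hb hτ h1 h2 ?_
      rw [← append_trunc_succ]
      exact hA.2
    · have hz : τ (δ ++ trunc δ' (m + 1)) = 0 := by
        by_contra hne
        exact hA ⟨by omega, hne⟩
      have hlt := pred_lt (levelA τ δ δ') (Nat.succ_ne_zero m)
      rw [pred_succ_of_notMem hA (Nat.succ_ne_zero m), Nat.sub_add_comm (Nat.lt_succ_iff.1 hlt),
        pow_succ (1 / (b : ℝ)), append_trunc_succ, state_append_singleton (by omega),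
        ← append_trunc_succ, hz, Int.cast_zero, add_zero, abs_div, abs_of_pos hb0, ← mul_assoc, mul_one_div]
      exact div_le_div_of_nonneg_right ih hb0.le

/-- Each level multiplies the potential by at least `ρ ^ levelCost`. The additional `1` in the
exponent pays for the initial factor `|μ̂(state δ)|² ≥ c² ≥ ρ`. -/
theorem pow_mul_weight_le (hb : 4 ≤ b) (hτ : IsTreeMapping b τ) {N : ℕ}
    (hN : ∀ δ : List (Fin q), N ≤ δ.length →
      -(1 / 2) ≤ state b τ ξ δ ∧ state b τ ξ δ ≤ 1 - 1 / b) {c ρ : ℝ} (hc0 : 0 < c)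
    (hc : ∀ y : ℝ, -(1 / 2) ≤ y → y ≤ 1 - 1 / b → c ≤ ‖cantorFourier q b y‖)
    (hρ0 : 0 < ρ) (hρ1 : ρ ≤ c ^ 2) (hρ2 : ρ ≤ (1 / b) ^ 2)
    (hρ3 : ρ ≤ c ^ 2 * (2 / (q * b) * (1 / (b : ℝ) ^ 2)) ^ 2) {δ : List (Fin q)}
    (hδ : N ≤ δ.length) (h0 : 1 / (b : ℝ) ^ 2 ≤ |state b τ ξ δ|) (δ' : List (Fin q)) (m : ℕ) :
    ρ ^ (1 + ∑ n ∈ Finset.Icc 1 m, levelCost τ δ δ' n) * weight b τ ξ δ ≤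
      weight b τ ξ (δ ++ trunc δ' m) *
        ‖cantorFourier q b (state b τ ξ (δ ++ trunc δ' m))‖ ^ 2 := by
  have hb1 : 1 < b := by omega
  have hF : ∀ m, c ^ 2 ≤ ‖cantorFourier q b (state b τ ξ (δ ++ trunc δ' m))‖ ^ 2 := fun m => by
    obtain ⟨h1, h2⟩ := hN (δ ++ trunc δ' m) (by rw [List.length_append]; omega)
    exact pow_le_pow_left₀ hc0.le (hc _ h1 h2) 2
  induction m with
  | zero =>
    simp only [trunc_zero, List.append_nil, Finset.Icc_eq_empty_of_lt zero_lt_one,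
      Finset.sum_empty, add_zero, pow_one]
    have := hF 0
    rw [trunc_zero, List.append_nil] at this
    rw [mul_comm]
    exact mul_le_mul_of_nonneg_left (hρ1.trans this) (weight_nonneg δ)
  | succ m ih =>
    have hF' := hF (m + 1)
    obtain ⟨h1, h2⟩ := hN (δ ++ trunc δ' m) (by rw [List.length_append]; omega)
    have hy := le_abs_state_append_trunc hb hτ hN hδ h0 δ' m
    have hst := state_append_singleton (b := b) (τ := τ) (ξ := ξ) (by omega)
      (δ ++ trunc δ' m) (extend δ' m)
    have hw := weight_append_singleton (b := b) (τ := τ) (ξ := ξ) (δ ++ trunc δ' m) (extend δ' m)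
    rw [← append_trunc_succ] at hst hw
    rw [hw, ← Finset.insert_Icc_right_eq_Icc_add_one (by omega), Finset.sum_insert (by simp)]
    set t := τ (δ ++ trunc δ' (m + 1)) with ht
    set y := state b τ ξ (δ ++ trunc δ' m) with hydef
    set P := weight b τ ξ (δ ++ trunc δ' m) with hP
    set y' := state b τ ξ (δ ++ trunc δ' (m + 1)) with hy'
    set s := ∑ n ∈ Finset.Icc 1 m, levelCost τ δ δ' n
    have hP0 : 0 ≤ P := weight_nonneg _
    have hPF : P * ‖cantorFourier q b y‖ ^ 2 ≤ P := weight_mul_norm_le _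
    have hrw : ρ ^ (1 + (levelCost τ δ δ' (m + 1) + s)) * weight b τ ξ δ =
        ρ ^ levelCost τ δ δ' (m + 1) * (ρ ^ (1 + s) * weight b τ ξ δ) := by
      rw [← mul_assoc, ← pow_add]
      congr 2
      ring
    rw [hrw]
    refine (mul_le_mul_of_nonneg_left ih (by positivity)).trans ?_
    have hyF := cantorFourier_eq_mask_mul (q := q) hb1 y
    by_cases hz : t = 0
    -- Zero label: by the functional equation the potential does not change.
    · have hcost : levelCost τ δ δ' (m + 1) = 0 := by
        simp [levelCost, levelA, levelB, ← ht, hz]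
      rw [hcost, pow_zero, one_mul, hst, hz, Int.cast_zero, add_zero, hyF, norm_mul, mul_pow,
        mul_assoc]
    by_cases hq : (q : ℤ) ∣ t
    -- Nonzero multiple of `q`: the mask is still evaluated at `y`, and `|mask q y| ≥ |μ̂(y)|`. Only
    -- the new factor `|μ̂(y')|² ≥ c²` is lost.
    · have hcost : levelCost τ δ δ' (m + 1) = 1 := by
        simp [levelCost, levelA, levelB, ← ht, hz, hq]
      have hmask : mask q (y + t) = mask q y := by
        rw [mask_add_congr y (Int.modEq_zero_iff_dvd.2 hq)]
        simp
      have h3 : ‖cantorFourier q b y‖ ≤ ‖mask q y‖ := by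
        rw [hyF, norm_mul]
        exact mul_le_of_le_one_right (norm_nonneg _) (norm_cantorFourier_le_one _)
      rw [hcost, pow_one, hmask, mul_comm ρ]
      have h4 : ‖cantorFourier q b y‖ ^ 2 ≤ ‖mask q y‖ ^ 2 :=
        pow_le_pow_left₀ (norm_nonneg _) h3 2
      exact mul_le_mul (mul_le_mul_of_nonneg_left h4 hP0) (hρ1.trans hF') hρ0.le (by positivity)
    -- Other labels: at level `n_j = m + 1` the gap `n_j - n_{j-1} - 1` is `m - pred`. One factor
    -- `ρ` absorbs the constants of the mask bound, and `ρ ^ g` absorbs the shrinking of `y`.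
    · have hcost : levelCost τ δ δ' (m + 1) = 1 + (m - pred (levelA τ δ δ') (m + 1)) := by
        have hA : m + 1 ∈ levelA τ δ δ' := ⟨by omega, hz⟩
        have hB : m + 1 ∈ levelB τ δ δ' := ⟨by omega, hq⟩
        rw [levelCost, if_pos hA, if_pos hB]
        omega
      rw [hcost, pow_add, pow_one]
      set g := m - pred (levelA τ δ δ') (m + 1)
      have h3 : 2 / (q * b) * (1 / (b : ℝ) ^ 2 * (1 / b) ^ g) ≤ ‖mask q (y + t)‖ :=
        (mul_le_mul_of_nonneg_left hy (by positivity)).trans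
          (le_norm_mask_add_int (by omega) h1 h2 t)
      have h4 := pow_le_pow_left₀ (by positivity) h3 2
      have h5 : ρ * ρ ^ g ≤ ‖mask q (y + t)‖ ^ 2 * c ^ 2 := by
        calc ρ * ρ ^ g ≤ (c ^ 2 * (2 / (q * b) * (1 / (b : ℝ) ^ 2)) ^ 2) * ((1 / b) ^ 2) ^ g :=
              mul_le_mul hρ3 (pow_le_pow_left₀ hρ0.le hρ2 g) (by positivity) (by positivity)
          _ = (2 / (q * b) * (1 / (b : ℝ) ^ 2 * (1 / b) ^ g)) ^ 2 * c ^ 2 := by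
              rw [← pow_mul, mul_comm 2 g, pow_mul]
              ring
          _ ≤ _ := mul_le_mul_of_nonneg_right h4 (by positivity)
      calc ρ * ρ ^ g * (P * ‖cantorFourier q b y‖ ^ 2)
          ≤ (‖mask q (y + t)‖ ^ 2 * c ^ 2) * P :=
            mul_le_mul h5 hPF (by positivity) (by positivity)
        _ ≤ (‖mask q (y + t)‖ ^ 2 * ‖cantorFourier q b y'‖ ^ 2) * P := by gcongr
        _ = _ := by ring

end Potential

/-! ### Completeness and orthonormality. -/

section Completeness

variable {q b : ℕ} [NeZero q] {τ : List (Fin q) → ℤ}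

theorem one_le_tsum_norm_cantorFourier_sq (hq : 2 ≤ q) (hqb : q < b) (hdvd : q ∣ b)
    (hτ : IsTreeMapping b τ) (hD : levelDiffSup τ < ⊤) (ξ : ℝ)
    (hs : Summable fun σ : regularSeq τ => ‖cantorFourier q b (ξ + frequency b τ σ)‖ ^ 2) :
    1 ≤ ∑' σ : regularSeq τ, ‖cantorFourier q b (ξ + frequency b τ σ)‖ ^ 2 := by
  -- A proper multiple of `q` is at least `2 * q`.
  have hb : 4 ≤ b := by
    obtain ⟨r, rfl⟩ := hdvd
    have : 2 ≤ r := by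
      by_contra h
      interval_cases r <;> omega
    nlinarith
  have hb0 : (0 : ℝ) < b := by
    have : 0 < b := by omega
    exact_mod_cast this
  have hq0 : (0 : ℝ) < q := by exact_mod_cast NeZero.pos q
  obtain ⟨N, hN⟩ := exists_state_bounds hb hτ ξ
  obtain ⟨K, hK⟩ := exists_forall_levelDiffAt_le hD
  obtain ⟨c, hc0, hc⟩ := exists_le_norm_cantorFourier (q := q) (show 2 ≤ b by omega)
  set ρ : ℝ := min (c ^ 2) (min ((1 / b) ^ 2)
    (c ^ 2 * (2 / (q * b) * (1 / (b : ℝ) ^ 2)) ^ 2)) with hρ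
  have hρ0 : 0 < ρ := lt_min (by positivity) (lt_min (by positivity) (by positivity))
  have hρ1 : ρ ≤ c ^ 2 := min_le_left _ _
  have hρ2 : ρ ≤ (1 / b) ^ 2 := (min_le_right _ _).trans (min_le_left _ _)
  have hρ3 : ρ ≤ c ^ 2 * (2 / (q * b) * (1 / (b : ℝ) ^ 2)) ^ 2 :=
    (min_le_right _ _).trans (min_le_right _ _)
  have hρle : ρ ≤ 1 := by
    refine hρ2.trans (pow_le_one₀ (by positivity) ?_)
    rw [div_le_one hb0]
    exact_mod_cast (show 1 ≤ b by omega)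
  set w : (ℕ → Fin q) → ℝ := fun σ => ‖cantorFourier q b (ξ + frequency b τ σ)‖ ^ 2 with hw
  have hw0 : ∀ σ, 0 ≤ w σ := fun σ => by positivity
  -- Depth `N + 1` puts the parent of `δ` at depth at least `N`, where the state bounds needed for
  -- `le_abs_state_append` hold.
  have hmass := le_of_uniform_escape (R := regularSeq τ) (w := w) (p := weight b τ ξ)
    (W := mass (regularSeq τ) w) (N := N + 1) (c := ρ ^ (1 + K)) (Nz := fun δ => τ δ ≠ 0)
    (by positivity) (pow_le_one₀ hρ0.le hρle) (weight_eq_sum hτ) (mass_eq_sum hs hw0)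
    (fun δ => tsum_nonneg fun σ => by split_ifs; exacts [hw0 _, le_rfl])
    (fun σ hσ => tendsto_weight_pre (by omega) hdvd hσ)
    (fun σ hσ n => le_mass hs hw0 hσ n) ?_ ?_
    (fun δ j hj => hτ.label_ne_zero δ hj)
  · rwa [weight_nil, mass_nil] at hmass
  · intro δ hδ hne
    obtain ⟨δ', hδ'⟩ := hK δ (List.ne_nil_of_length_pos (by omega))
    have hreg := extend_append_mem_regularSeq (finite_levelA hδ')
    refine ⟨_, hreg, ?_, ?_⟩
    · have := pre_extend_append δ δ' 0
      simpa [trunc_zero] using this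
    have hst : 1 / (b : ℝ) ^ 2 ≤ |state b τ ξ δ| := by
      obtain ⟨δ₀, j, rfl⟩ := (List.eq_nil_or_concat δ).resolve_left
        (List.ne_nil_of_length_pos (by omega))
      rw [List.concat_eq_append] at hδ hne ⊢
      rw [List.length_append, List.length_singleton] at hδ
      obtain ⟨h1, h2⟩ := hN δ₀ (by omega)
      exact le_abs_state_append hb hτ h1 h2 hne
    obtain ⟨n, hn, hnδ⟩ := ((norm_cantorFourier_frequency_eventuallyEq (ξ := ξ) (by omega) hdvd
      hreg).and (eventually_ge_atTop δ.length)).exists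
    obtain ⟨m, rfl⟩ := Nat.exists_eq_add_of_le hnδ
    rw [pre_extend_append] at hn
    refine le_trans ?_ ((pow_mul_weight_le hb hτ hN hc0 hc hρ0 hρ1 hρ2 hρ3
      (by omega : N ≤ δ.length) hst δ' m).trans hn.ge)
    refine mul_le_mul_of_nonneg_right (pow_le_pow_of_le_one hρ0.le hρle ?_) (weight_nonneg δ)
    have := (sum_levelCost_le δ δ' (Finset.Icc 1 m)).trans hδ'
    have := Nat.cast_le.1 this
    omega
  · intro δ hδ hz
    -- The state at `δ` may be arbitrarily small here, so the potential bound is unavailable. But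
    -- `δ000⋯` has zero labels from `δ` on, and it retains the full potential, at least `c² * weight
    -- δ`.
    have hz' : ∀ m, δ.length ≤ m → τ (pre (extend δ) m) = 0 := by
      intro m hm
      obtain ⟨k, rfl⟩ := Nat.exists_eq_add_of_le hm
      rw [pre_extend, trunc_length_add]
      exact not_not.1 (hz k)
    refine ⟨extend δ, eventually_atTop.2 ⟨_, hz'⟩, pre_extend_length δ, ?_⟩
    have h1 := frequency_eq_labelSum (b := b) (n := δ.length)
      (fun m hm => hz' (m + 1) (by omega))
    have h2 := norm_cantorFourier_sq_eq_weight_mul (ξ := ξ) (τ := τ) (by omega : 1 < b) hdvd δ 0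
    rw [pre_extend_length] at h1
    rw [Int.cast_zero, mul_zero, add_zero, add_zero] at h2
    simp only [hw]
    rw [h1, h2, mul_comm]
    refine mul_le_mul_of_nonneg_left ?_ (weight_nonneg δ)
    obtain ⟨h3, h4⟩ := hN δ (by omega)
    refine le_trans ?_ (pow_le_pow_left₀ hc0.le (hc _ h3 h4) 2)
    refine le_trans ?_ hρ1
    exact pow_le_of_le_one hρ0.le hρle (by omega)

theorem inner_expL2_cantorMeasure (l l' : ℝ) :
    inner ℂ (expL2 (cantorMeasure q b) l) (expL2 (cantorMeasure q b) l') =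
      cantorFourier q b (l' - l) :=
  inner_expL2 _ l l'

theorem norm_expL2_cantorMeasure (l : ℝ) : ‖expL2 (cantorMeasure q b) l‖ = 1 := by
  have h := inner_self_eq_norm_sq (𝕜 := ℂ) (expL2 (cantorMeasure q b) l)
  rw [inner_expL2_cantorMeasure, sub_self, cantorFourier_zero, RCLike.one_re] at h
  exact (pow_eq_one_iff_of_nonneg (norm_nonneg _) two_ne_zero).1 h.symm

theorem orthonormal_expL2_frequency (hb : 1 < b) (hdvd : q ∣ b) (hτ : IsTreeMapping b τ) :
    Orthonormal ℂ fun σ : regularSeq τ => expL2 (cantorMeasure q b) (frequency b τ σ) := by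
  refine ⟨fun σ => norm_expL2_cantorMeasure _, fun σ σ' hne => ?_⟩
  beta_reduce
  rw [inner_expL2_cantorMeasure]
  exact cantorFourier_frequency_sub_eq_zero hb hdvd hτ σ'.2 σ.2
    fun h => hne (Subtype.ext h.symm)

end Completeness

end CantorTree

end

/-! ### The main theorem. -/

theorem mainTheorem1 (q b : ℕ) [NeZero q] (hq : 2 ≤ q) (hqb : q < b) (hdvd : q ∣ b)
    (τ : List (Fin q) → ℤ) (hτ : CantorTree.IsMaximalTreeMapping b τ)
    (hD : CantorTree.levelDiffSup τ < ⊤) :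
    CantorTree.IsSpectrum (CantorTree.cantorMeasure q b) (CantorTree.spectrumSet b τ) := by
  open CantorTree in
  have hb : 1 < b := by omega
  have ht := hτ.toIsTreeMapping
  have hon := orthonormal_expL2_frequency hb hdvd ht
  rw [spectrumSet_eq_image ht]
  refine ⟨?_, ?_⟩
  · rintro _ ⟨σ, hσ, rfl⟩ _ ⟨σ', hσ', rfl⟩ hne
    exact hon.2 (i := ⟨σ, hσ⟩) (j := ⟨σ', hσ'⟩) fun h =>
      hne (congrArg (frequency b τ) (Subtype.ext_iff.1 h))
  · rw [eq_top_iff, ← topologicalClosure_span_range_expL2]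
    refine Submodule.topologicalClosure_minimal _ (Submodule.span_le.2 ?_)
      (Submodule.isClosed_topologicalClosure _)
    rintro _ ⟨ξ, rfl⟩
    -- The inner product is `μ̂(ξ - λ)`, and `|μ̂|` is even, so the tree estimate is used at `-ξ`.
    have hinner : ∀ σ : regularSeq τ, ‖inner ℂ (expL2 (cantorMeasure q b) (frequency b τ σ))
        (expL2 (cantorMeasure q b) ξ)‖ ^ 2 =
        ‖cantorFourier q b (-ξ + frequency b τ σ)‖ ^ 2 := fun σ => by
      rw [inner_expL2_cantorMeasure, ← norm_cantorFourier_neg, neg_sub, neg_add_eq_sub]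
    have hs := hon.inner_products_summable (expL2 (cantorMeasure q b) ξ)
    simp_rw [hinner] at hs
    have h1 := one_le_tsum_norm_cantorFourier_sq hq hqb hdvd ht hD (-ξ) hs
    simp_rw [← hinner] at h1
    have h2 := mem_topologicalClosure_span_of_one_le_tsum hon (norm_expL2_cantorMeasure ξ) h1
    rwa [Set.image_image, Set.image_eq_range]
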